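/- **Setting.** Let $n>1$ and $0\le l\le n$ be integers, let $0<\kappa<N$ be relatively prime integers, and let $k,k'$ be positive integers with $\kappa k\equiv -1$ and $\kappa k'\equiv 2 \pmod N$. Write $z=(z_1,\dots,z_n)$, $t=(t_1,\dots,t_l)$, and $[x]_m=\prod_{i=0}^{m-1}(x-i\kappa)$, $[x]_0=1$. Let $V$ be the $\mathfrak{sl}_2$-module with basis $v_1,v_2$, where $ev_1=0$, $ev_2=v_1$, $hv_1=v_1$, $hv_2=-v_2$. Let $\mathcal I_l$ be the set of $l$-element subsets of $\{1,\dots,n\}$. For $I\in\mathcal I_l$ let $v_I\in V^{\otimes n}$ be the tensor product with factor $v_2$ in the positions $j\in I$ and $v_1$ in the others. The vectors $v_I$, $I\in\mathcal I_l$, form a basis of $V^{\otimes n}[n-2l]$, the eigenspace of $h$ with eigenvalue $n-2l$. **The integrand.** The master polynomial is $$\Phi(t,z)=\prod_{a=1}^n\prod_{i=1}^l[t_i-z_a]_k\prod_{1\le i<j\le l}[t_i-t_j+1]_{k'} .$$ For $\tau\in S_l$ and a rational function $g$ of $t$ put $$(\tau g)(t)=g(t_{\tau(1)},\dots,t_{\tau(l)})\prod_{i<j,\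 \tau^{-1}(i)>\tau^{-1}(j)}\frac{t_i-t_j+1-\kappa k'}{t_i-t_j+1}.$$ For $I=\{a_1<\dots<a_l\}$ let $$w_I^\tau(t,z)=\tau\Big(\prod_{i=1}^l\frac1{t_i-z_{a_i}}\prod_{j=1}^{a_i-1}\frac{t_i-z_j-\kappa k}{t_i-z_j}\Big),\qquad U_I=\sum_{\tau\in S_l}\Phi\, w_I^\tau,\qquad U(t,z)=\sum_{I\in\mathcal I_l}U_I(t,z)\,v_I .$$ **Difference integrals.** For $r=(r_1,\dots,r_l)\in\mathbb Z_{\ge0}^l$ let $N_r$ be the least positive integer with $N_r(r_i+1)\equiv0\pmod N$ for all $i$. The products $\prod_i[t_i]_{m_i}$, $m\in\mathbb Z_{\ge 0}^l$, form a $\mathbb Z[z]$-basis of $\mathbb Z[z][t]$. For $g=\sum_m c_m(z)\prod_i[t_i]_{m_i}\in\mathbb Z[z][t]$ put $\{g\}_r^t=N_r\,c_r(z)$. **Equations.** Let $P^{(a,b)}$ swap the $a$-th and $b$-th factors of $V^{\otimes n}$. Let $R^{(a,b)}(u)=\frac{u-P^{(a,b)}}{u-1}$ and $P^{(\mu)}=P^{(1,2)}P^{(2,3)}\cdots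 P^{(n-1,n)}$, and $$K_a(z;\kappa)=R^{(a,a-1)}(z_a-z_{a-1}-\kappa)\cdots R^{(a,1)}(z_a-z_1-\kappa)\,R^{(a,n)}(z_a-z_n)\cdots R^{(a,a+1)}(z_a-z_{a+1}).$$ Two rational functions in $z$ are congruent modulo $N$ if their difference is $Np/q$ with $p,q\in\mathbb Z[z]$ and $q$ not a zero divisor in $(\mathbb Z/N\mathbb Z)[z]$. Vectors are congruent modulo $N$ if their coordinates in the standard basis of $V^{\otimes n}$ are. **Theorem.** All $U_I$ are polynomials in $t,z$ with integer coefficients. For every $r\in\mathbb Z_{\ge0}^l$ the difference $r$-integral $$f_r(z)=\{U\}^t_r=\sum_{I\in\mathcal I_l}\{U_I\}^t_r\,v_I$$ is a $V^{\otimes n}[n-2l]$-valued polynomial in $z$ whose coordinates have integer coefficients, and: 1. $f=f_r$ satisfies the symmetric qKZ equations modulo $N$: $$f(z_1,\dots,z_{a+1},z_a,\dots,z_n)\equiv P^{(a,a+1)}R^{(a,a+1)}(z_a-z_{a+1})f(z)\pmod N,\quad a=1,\dots,n-1,$$ $$f(z_1-\kappa,z_2,\dots,z_n)\equiv P^{(\mu)}f(z_2,\dots,z_n,z_1)\pmod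 N;$$ 2. $f=f_r$ satisfies the qKZ equations modulo $N$: $f(z_1,\dots,z_a-\kappa,\dots,z_n)\equiv K_a(z;\kappa)f(z)\pmod N$ for $a=1,\dots,n$; 3. $f_r$ is a singular vector modulo $N$: $e f_r(z)\equiv0\pmod N$. -/

import Mathlib

open scoped TensorProduct

noncomputable section

/-! ### Strings (Pochhammer polynomials) -/

/-- The string `[x]_m = x (x - κ) ⋯ (x - (m - 1) κ)` with step `κ`, with `[x]_0 = 1`. -/
def poch {R : Type*} [CommRing R] (κ m : ℕ) (x : R) : R :=
  ∏ i ∈ Finset.range m, (x - (i : R) * (κ : R))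

/-- The product of strings `[t_1]_{m_1} ⋯ [t_l]_{m_l}` in `A[t_1, …, t_l]`. -/
def pochMonomial (A : Type*) [CommRing A] (l κ : ℕ) (m : Fin l → ℕ) : MvPolynomial (Fin l) A :=
  ∏ i, poch κ (m i) (MvPolynomial.X i)

/-- `p` has no terms of total degree `≥ a`. -/
def LowTerms {A : Type*} [CommRing A] {l : ℕ} (a : ℕ) (p : MvPolynomial (Fin l) A) : Prop :=
  ∀ d : Fin l →₀ ℕ, a ≤ d.degree → p.coeff d = 0

theorem LowTerms.mul {A : Type*} [CommRing A] {l a b : ℕ} {p q : MvPolynomial (Fin l) A}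
    (hp : LowTerms a p) (hq : LowTerms (b + 1) q) : LowTerms (a + b) (p * q) := by
  intro d hd
  rw [MvPolynomial.coeff_mul]
  refine Finset.sum_eq_zero fun x hx => ?_
  have hx' : x.1 + x.2 = d := by simpa using hx
  have hdeg : x.1.degree + x.2.degree = d.degree := by rw [← hx', map_add]
  by_cases h1 : a ≤ x.1.degree
  · rw [hp _ h1, zero_mul]
  · rw [hq _ (by omega), mul_zero]

theorem lowTerms_monomial {A : Type*} [CommRing A] {l a : ℕ} (m : Fin l →₀ ℕ) (c : A)
    (h : m.degree < a) : LowTerms a (MvPolynomial.monomial m c) := by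
  intro d hd
  rw [MvPolynomial.coeff_monomial, if_neg]
  rintro rfl
  omega

theorem LowTerms.add {A : Type*} [CommRing A] {l a : ℕ} {p q : MvPolynomial (Fin l) A}
    (hp : LowTerms a p) (hq : LowTerms a q) : LowTerms a (p + q) := by
  intro d hd
  rw [MvPolynomial.coeff_add, hp d hd, hq d hd, add_zero]

theorem LowTerms.mono {A : Type*} [CommRing A] {l a b : ℕ} {p : MvPolynomial (Fin l) A}
    (hp : LowTerms a p) (h : a ≤ b) : LowTerms b p := fun d hd => hp d (h.trans hd)

theorem lowTerms_mul_sub {A : Type*} [CommRing A] {l : ℕ} {p q : MvPolynomial (Fin l) A}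
    {m m' : Fin l →₀ ℕ} (hp : LowTerms m.degree (p - MvPolynomial.monomial m 1))
    (hq : LowTerms m'.degree (q - MvPolynomial.monomial m' 1)) :
    LowTerms (m + m').degree (p * q - MvPolynomial.monomial (m + m') 1) := by
  have e : p * q - MvPolynomial.monomial (m + m') 1
      = (p - MvPolynomial.monomial m 1) * q
        + (q - MvPolynomial.monomial m' 1) * MvPolynomial.monomial m 1 := by
    have : (MvPolynomial.monomial (m + m') (1 : A))
        = MvPolynomial.monomial m 1 * MvPolynomial.monomial m' 1 := by
      rw [MvPolynomial.monomial_mul, one_mul]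
    rw [this]; ring
  have hq' : LowTerms (m'.degree + 1) q := by
    have := (hq.mono (Nat.le_succ _)).add (lowTerms_monomial (a := m'.degree + 1) m' 1 (by omega))
    simpa using this
  rw [e, map_add]
  refine (hp.mul hq').add ?_
  rw [add_comm]
  exact hq.mul (lowTerms_monomial _ _ (by omega))

theorem lowTerms_poch {A : Type*} [CommRing A] {l : ℕ} (κ : ℕ) (i : Fin l) (m : ℕ) :
    LowTerms (Finsupp.single i m).degree
      (poch κ m (MvPolynomial.X i) - MvPolynomial.monomial (Finsupp.single i m) (1 : A)) := by
  induction m with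
  | zero => simp [poch, LowTerms]
  | succ m ih =>
    rw [poch, Finset.prod_range_succ, Finsupp.single_add]
    refine lowTerms_mul_sub ih ?_
    intro d hd
    have hc : ((m : MvPolynomial (Fin l) A) * (κ : MvPolynomial (Fin l) A))
        = MvPolynomial.monomial 0 ((m : A) * (κ : A)) := by
      rw [← MvPolynomial.C_apply, map_mul, map_natCast, map_natCast]
    rw [MvPolynomial.X, sub_right_comm, sub_self, zero_sub, MvPolynomial.coeff_neg, hc,
      MvPolynomial.coeff_monomial, if_neg, neg_zero]
    rintro rfl
    simp at hd

theorem lowTerms_pochMonomial {A : Type*} [CommRing A] {l : ℕ} (κ : ℕ) (m : Fin l → ℕ) :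
    LowTerms (Finsupp.equivFunOnFinite.symm m).degree
      (pochMonomial A l κ m
        - MvPolynomial.monomial (Finsupp.equivFunOnFinite.symm m) (1 : A)) := by
  have key : ∀ s : Finset (Fin l), LowTerms (∑ i ∈ s, Finsupp.single i (m i)).degree
      (∏ i ∈ s, poch κ (m i) (MvPolynomial.X i)
        - MvPolynomial.monomial (∑ i ∈ s, Finsupp.single i (m i)) (1 : A)) := by
    intro s
    induction s using Finset.induction_on with
    | empty => simp [LowTerms]
    | insert i s his ih =>
      rw [Finset.sum_insert his, Finset.prod_insert his]
      exact lowTerms_mul_sub (lowTerms_poch κ i (m i)) ih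
  have h := key Finset.univ
  have e : (∑ i, Finsupp.single i (m i)) = Finsupp.equivFunOnFinite.symm m := by
    ext j
    simp [Finsupp.finsetSum_apply, Finsupp.single_apply]
  rwa [e] at h

theorem pochMonomial_linearIndependent (A : Type*) [CommRing A] (l κ : ℕ) :
    LinearIndependent A (pochMonomial A l κ) := by
  classical
  rw [linearIndependent_iff']
  intro s g hg
  by_contra hcon
  push Not at hcon
  obtain ⟨i₀, hi₀, hgi₀⟩ := hcon
  obtain ⟨m, hm, hmax⟩ := (s.filter fun i => g i ≠ 0).exists_max_image
    (fun i => (Finsupp.equivFunOnFinite.symm i).degree) ⟨i₀, by simp [hi₀, hgi₀]⟩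
  rw [Finset.mem_filter] at hm
  have h0 := congrArg (MvPolynomial.coeff (Finsupp.equivFunOnFinite.symm m)) hg
  rw [MvPolynomial.coeff_sum, MvPolynomial.coeff_zero, Finset.sum_eq_single m] at h0
  · have h1 := lowTerms_pochMonomial (A := A) κ m _ le_rfl
    rw [MvPolynomial.coeff_sub, MvPolynomial.coeff_monomial, if_pos rfl, sub_eq_zero] at h1
    rw [MvPolynomial.coeff_smul, h1, smul_eq_mul, mul_one] at h0
    exact hm.2 h0
  · intro m' hm' hne
    rw [MvPolynomial.coeff_smul]
    by_cases hz : g m' = 0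
    · rw [hz, zero_smul]
    · have h1 := lowTerms_pochMonomial (A := A) κ m' (Finsupp.equivFunOnFinite.symm m)
        (hmax m' (by simp [hm', hz]))
      rw [MvPolynomial.coeff_sub, MvPolynomial.coeff_monomial, if_neg, sub_zero] at h1
      · rw [h1, smul_zero]
      · exact fun h => hne (Finsupp.equivFunOnFinite.symm.injective h)
  · exact fun h => absurd hm.1 h

theorem pochMonomial_span (A : Type*) [CommRing A] (l κ : ℕ) :
    ⊤ ≤ Submodule.span A (Set.range (pochMonomial A l κ)) := by
  have key : ∀ a : ℕ, ∀ p : MvPolynomial (Fin l) A, LowTerms a p →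
      p ∈ Submodule.span A (Set.range (pochMonomial A l κ)) := by
    intro a
    induction a with
    | zero =>
      intro p hp
      have : p = 0 := by ext d; simpa using hp d (Nat.zero_le _)
      rw [this]; exact Submodule.zero_mem _
    | succ a ih =>
      intro p hp
      rw [p.as_sum]
      refine Submodule.sum_mem _ fun d hd => ?_
      have hdeg : d.degree ≤ a := by
        by_contra hlt
        exact (MvPolynomial.mem_support_iff.1 hd) (hp d (by omega))
      have e : MvPolynomial.monomial d (p.coeff d) = p.coeff d • MvPolynomial.monomial d (1 : A) := by
        rw [MvPolynomial.smul_monomial, smul_eq_mul, mul_one]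
      rw [e]
      refine Submodule.smul_mem _ _ ?_
      have h1 := lowTerms_pochMonomial (A := A) κ (Finsupp.equivFunOnFinite d)
      rw [Equiv.symm_apply_apply] at h1
      have h2 := ih _ (h1.mono hdeg)
      have h3 : pochMonomial A l κ (Finsupp.equivFunOnFinite d) ∈
          Submodule.span A (Set.range (pochMonomial A l κ)) := Submodule.subset_span ⟨_, rfl⟩
      simpa using Submodule.sub_mem _ h3 h2
  intro p _
  refine key (p.totalDegree + 1) p fun d hd => ?_
  refine MvPolynomial.coeff_eq_zero_of_totalDegree_lt ?_
  have : d.degree = ∑ i ∈ d.support, d i := rfl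
  omega

/-- The products of strings `[t_1]_{m_1} ⋯ [t_l]_{m_l}` form an `A`-basis of `A[t_1, …, t_l]`. -/
def pochBasis (A : Type*) [CommRing A] (l κ : ℕ) :
    Module.Basis (Fin l → ℕ) A (MvPolynomial (Fin l) A) :=
  Module.Basis.mk (pochMonomial_linearIndependent A l κ) (pochMonomial_span A l κ)

/-! ### Difference integrals -/

/-- `N_r`: the least positive integer with `N_r (r_i + 1) ≡ 0 (mod N)` for all `i`. -/
def intFactor {l : ℕ} (N : ℕ) (r : Fin l → ℕ) : ℕ :=
  sInf {m : ℕ | 0 < m ∧ ∀ i, N ∣ m * (r i + 1)}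

/-- The difference `r`-integral `{f}_r^t = N_r c_r`, where `c_r` is the coefficient of
`[t_1]_{r_1} ⋯ [t_l]_{r_l}` in `f`. -/
def diffIntegral {A : Type*} [CommRing A] {l : ℕ} (N κ : ℕ) (r : Fin l → ℕ)
    (f : MvPolynomial (Fin l) A) : A :=
  (intFactor N r : A) * (pochBasis A l κ).repr f r

/-! ### Master polynomial, weight functions, and the integrand -/

/-- The ring `ℤ[z_1, …, z_n]`. -/
abbrev PolyZ (n : ℕ) : Type := MvPolynomial (Fin n) ℤ

/-- The ring `ℤ[z_1, …, z_n][t_1, …, t_l]`. -/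
abbrev PolyTZ (l n : ℕ) : Type := MvPolynomial (Fin l) (PolyZ n)

/-- The field of rational functions in `z_1, …, z_n`. -/
abbrev RatZ (n : ℕ) : Type := FractionRing (PolyZ n)

/-- The field of rational functions in `t_1, …, t_l, z_1, …, z_n`. -/
abbrev RatTZ (l n : ℕ) : Type := FractionRing (PolyTZ l n)

/-- The set `𝓘_l` of `l`-element subsets of the index set. -/
abbrev LSubset (l n : ℕ) : Type := {I : Finset (Fin n) // I.card = l}

/-- The master polynomial
`Φ(t, z) = ∏_a ∏_i [t_i - z_a]_k ∏_{i < j} [t_i - t_j + 1]_{k'}`. -/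
def masterPoly (l n κ k k' : ℕ) : PolyTZ l n :=
  (∏ a : Fin n, ∏ i : Fin l,
      poch κ k (MvPolynomial.X i - MvPolynomial.C (MvPolynomial.X a))) *
    ∏ i : Fin l, ∏ j ∈ Finset.Ioi i, poch κ k' (MvPolynomial.X i - MvPolynomial.X j + 1)

/-- For `I = {a_1 < ⋯ < a_l}`, the rational function
`∏_i 1 / (t_i - z_{a_i}) ∏_{j < a_i} (t_i - z_j - κ k) / (t_i - z_j)`
of `t`, evaluated at a point of `F^l`. -/
def weightTerm {F : Type*} [Field F] {l n : ℕ} (κ k : ℕ) (z : Fin n → F) (I : LSubset l n)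
    (t : Fin l → F) : F :=
  ∏ i : Fin l, (1 / (t i - z (I.1.orderEmbOfFin I.2 i)) *
    ∏ j ∈ Finset.Iio (I.1.orderEmbOfFin I.2 i), (t i - z j - (κ : F) * (k : F)) / (t i - z j))

/-- The modified action of a permutation `τ` on functions of `t = (t_1, …, t_l)`:
`(τ f)(t) = f(t_{τ(1)}, …, t_{τ(l)}) ∏ (t_i - t_j + 1 - κ k') / (t_i - t_j + 1)`,
over the pairs `i < j` such that `t_j` stands before `t_i` in `(t_{τ(1)}, …, t_{τ(l)})`. -/
def permAct {F : Type*} [Field F] {l : ℕ} (κ k' : ℕ) (τ : Equiv.Perm (Fin l))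
    (f : (Fin l → F) → F) (t : Fin l → F) : F :=
  f (fun i => t (τ i)) *
    ∏ i : Fin l, ∏ j ∈ (Finset.Ioi i).filter (fun j => τ.symm j < τ.symm i),
      ((t i - t j + 1 - (κ : F) * (k' : F)) / (t i - t j + 1))

/-- The symmetrization modulo `N`: the sum of all `τ f`. -/
def symmetrize {F : Type*} [Field F] {l : ℕ} (κ k' : ℕ) (f : (Fin l → F) → F)
    (t : Fin l → F) : F :=
  ∑ τ : Equiv.Perm (Fin l), permAct κ k' τ f t

/-- The coordinate `w_I(t, z)` of the weight function, a rational function in `t` and `z`. -/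
def weightFn {l n : ℕ} (κ k k' : ℕ) (I : LSubset l n) : RatTZ l n :=
  symmetrize κ k'
    (weightTerm κ k (fun a => algebraMap (PolyTZ l n) _ (MvPolynomial.C (MvPolynomial.X a))) I)
    (fun i => algebraMap (PolyTZ l n) _ (MvPolynomial.X i))

/-- The polynomials `U_I` are the coordinates of the integrand: `U_I = Φ w_I` as rational
functions. -/
def IsIntegrand {l n : ℕ} (κ k k' : ℕ) (U : LSubset l n → PolyTZ l n) : Prop :=
  ∀ I, algebraMap (PolyTZ l n) (RatTZ l n) (U I) =
    algebraMap (PolyTZ l n) (RatTZ l n) (masterPoly l n κ k k') * weightFn κ k k' I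

/-! ### The tensor power of the vector representation -/

/-- The `n`-th tensor power `V^{⊗ n}` of the two-dimensional space `V = K v_1 ⊕ K v_2`;
`v_1` and `v_2` are the standard basis vectors with indices `0` and `1`. -/
abbrev VTensor (K : Type) [Field K] (n : ℕ) : Type := ⨂[K]^n (Fin 2 → K)

/-- The basis vector `v_I`: the factor `v_2` in the positions of `I`, and `v_1` elsewhere. -/
def vBasis (K : Type) [Field K] {n : ℕ} (I : Finset (Fin n)) : VTensor K n :=
  PiTensorProduct.tprod K fun j => Pi.single (if j ∈ I then (1 : Fin 2) else 0) (1 : K)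

/-- The standard basis of `V^{⊗ n}` made of the tensor products of the vectors `v_1`, `v_2`. -/
def stdBasis (K : Type) [Field K] (n : ℕ) : Module.Basis (Fin n → Fin 2) K (VTensor K n) :=
  Basis.piTensorProduct fun _ => Pi.basisFun K (Fin 2)

/-- The diagonal action on `V^{⊗ n}` of an operator `x` of the Lie algebra acting on `V`. -/
def diagAct {K : Type} [Field K] {n : ℕ} (x : Module.End K (Fin 2 → K)) :
    Module.End K (VTensor K n) :=
  ∑ a : Fin n, PiTensorProduct.map (Function.update (fun _ => LinearMap.id) a x)

/-- The action of `e` on `V`: `e v_1 = 0`, `e v_2 = v_1`. -/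
def sl2e (K : Type) [Field K] : Module.End K (Fin 2 → K) := Matrix.toLin' !![0, 1; 0, 0]

/-- The action of `h` on `V`: `h v_1 = v_1`, `h v_2 = -v_2`. -/
def sl2h (K : Type) [Field K] : Module.End K (Fin 2 → K) := Matrix.toLin' !![1, 0; 0, -1]

/-- `P^{(a,b)}`: the operator swapping the `a`-th and the `b`-th tensor factors. -/
def permOp (K : Type) [Field K] {n : ℕ} (a b : Fin n) : Module.End K (VTensor K n) :=
  (PiTensorProduct.reindex K (fun _ : Fin n => Fin 2 → K) (Equiv.swap a b)).toLinearMap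

/-- `R^{(a,b)}(u) = (u - P^{(a,b)}) / (u - 1)`. -/
def RMat {K : Type} [Field K] {n : ℕ} (a b : Fin n) (u : K) : Module.End K (VTensor K n) :=
  (u - 1)⁻¹ • (u • (1 : Module.End K (VTensor K n)) - permOp K a b)

/-- `P^{(μ)} = P^{(1,2)} P^{(2,3)} ⋯ P^{(n-1,n)}`. -/
def cycleOp (K : Type) [Field K] (n : ℕ) : Module.End K (VTensor K n) :=
  ((List.finRange (n - 1)).map fun i =>
    permOp K (⟨i.1, by omega⟩ : Fin n) (⟨i.1 + 1, by omega⟩ : Fin n)).prod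

/-- The variable `z_a` as a rational function. -/
def zVar {n : ℕ} (a : Fin n) : RatZ n := algebraMap (PolyZ n) (RatZ n) (MvPolynomial.X a)

/-- The `qKZ` operator `K_a(z; κ)`, that is
`R^{(a,a-1)}(z_a - z_{a-1} - κ) ⋯ R^{(a,1)}(z_a - z_1 - κ)
  R^{(a,n)}(z_a - z_n) ⋯ R^{(a,a+1)}(z_a - z_{a+1})`. -/
def qKZOp {n : ℕ} (κ : ℕ) (a : Fin n) : Module.End (RatZ n) (VTensor (RatZ n) n) :=
  (((List.finRange n).reverse.filter (fun b => b < a)).map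
      fun b => RMat a b (zVar a - zVar b - (κ : RatZ n))).prod *
    (((List.finRange n).reverse.filter (fun b => a < b)).map
      fun b => RMat a b (zVar a - zVar b)).prod

/-! ### Congruences and equations modulo `N` -/

/-- Congruence modulo `N` of rational functions with integer coefficients: the difference is
`N p / q` with polynomials `p`, `q` over `ℤ` such that `q` is not a zero divisor modulo `N`. -/
def RatCongr {n : ℕ} (N : ℕ) (x y : RatZ n) : Prop :=
  ∃ p q : PolyZ n,
    MvPolynomial.map (Int.castRingHom (ZMod N)) q ∈ nonZeroDivisors (MvPolynomial (Fin n) (ZMod N)) ∧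
      algebraMap (PolyZ n) (RatZ n) q * (x - y) =
        algebraMap (PolyZ n) (RatZ n) ((N : PolyZ n) * p)

/-- Congruence modulo `N` of vectors: all coordinates in the standard basis are congruent. -/
def VecCongr {n : ℕ} (N : ℕ) (x y : VTensor (RatZ n) n) : Prop :=
  ∀ j, RatCongr N ((stdBasis (RatZ n) n).repr x j) ((stdBasis (RatZ n) n).repr y j)

/-- The vector `∑_I f_I(s_1, …, s_n) v_I` obtained from `f(z) = ∑_I f_I(z) v_I` by the
substitution `z_a ↦ s_a`. -/
def vecAt {l n : ℕ} (f : LSubset l n → PolyZ n) (s : Fin n → PolyZ n) : VTensor (RatZ n) n :=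
  ∑ I : LSubset l n,
    algebraMap (PolyZ n) (RatZ n) (MvPolynomial.bind₁ s (f I)) • vBasis (RatZ n) I.1

/-- The substitution `z_a ↦ z_a - κ`, the other variables being fixed. -/
def shiftVar {n : ℕ} (κ : ℕ) (a : Fin n) : Fin n → PolyZ n :=
  Function.update MvPolynomial.X a (MvPolynomial.X a - (κ : PolyZ n))

/-- `f` satisfies the `qKZ` equations modulo `N`:
`f(z_1, …, z_a - κ, …, z_n) ≡ K_a(z; κ) f(z)` for all `a`. -/
def SolvesQKZ {l n : ℕ} (N κ : ℕ) (f : LSubset l n → PolyZ n) : Prop :=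
  ∀ a : Fin n, VecCongr N (vecAt f (shiftVar κ a)) (qKZOp κ a (vecAt f MvPolynomial.X))

/-- `f` satisfies the symmetric `qKZ` equations modulo `N`:
`f(…, z_{a+1}, z_a, …) ≡ P^{(a,a+1)} R^{(a,a+1)}(z_a - z_{a+1}) f(z)` for `a = 1, …, n - 1`, and
`f(z_1 - κ, z_2, …, z_n) ≡ P^{(μ)} f(z_2, …, z_n, z_1)`. -/
def SolvesSymmQKZ {l n : ℕ} (N κ : ℕ) (f : LSubset l n → PolyZ n) : Prop :=
  (∀ a b : Fin n, a.1 + 1 = b.1 →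
    VecCongr N (vecAt f fun c => MvPolynomial.X (Equiv.swap a b c))
      (permOp _ a b (RMat a b (zVar a - zVar b) (vecAt f MvPolynomial.X)))) ∧
  (∀ a : Fin n, a.1 = 0 →
    VecCongr N (vecAt f (shiftVar κ a))
      (cycleOp _ n (vecAt f fun c => MvPolynomial.X (finRotate n c))))

/-- `f` takes values in the weight space `V^{⊗ n}[n - 2 l]`: `h f = (n - 2 l) f`. -/
def HasWeight {l n : ℕ} (f : LSubset l n → PolyZ n) : Prop :=
  diagAct (sl2h (RatZ n)) (vecAt f MvPolynomial.X) =
    ((n : RatZ n) - 2 * (l : RatZ n)) • vecAt f MvPolynomial.X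

/-- `f` is a singular vector modulo `N`: `e f ≡ 0`. -/
def IsSingularMod {l n : ℕ} (N : ℕ) (f : LSubset l n → PolyZ n) : Prop :=
  VecCongr N (diagAct (sl2e (RatZ n)) (vecAt f MvPolynomial.X)) 0

end

/-!
A term of `U_I`, given by a permutation `τ`, is encoded by the placement `s`, the injective map
`s : Fin l → Fin n` with image `I` for which `z_{s i}` is the point attached to `t_i`. Multiplying the
weight function by the master polynomial cancels all denominators, since `[x]_m (x - κ m) / x` is
`[x - κ]_m`. The result is an ordered product (`orderedTerm`) of strings which depends only on the
relative order of the positions of the variables and the points, and makes sense over every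
commutative ring. Three relations for the sums of these products give the theorem; they are proved
over rings in which `N = 0`, `κ k = -1` and `κ k' = 2`, and transferred to `ℤ[z]` by reduction
modulo `N`.

* Exchange (`integralAt_swap`). When `κ k = -1` and `κ k' = 2`, all ordered products have a common
  factor symmetric in `z`, and what remains are products of the linear factors `x`, `x + 1` for
  `x = t_i - z_a` and `d + 1`, `d - 1` for `d = t_i - t_j`. For two neighbouring points `z_a`, `z_b`
  the relation `(u - 1) U(…, z_b, z_a, …) = (u P - 1) U(z)`, `u = z_a - z_b`, is an identity of
  polynomials (`redSum_swap`).
* Rotation (`integralAt_rotate`). Replacing `z_1` by `z_1 - κ` amounts to moving `z_1` to the last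
  place, together with the variable `t_m` attached to it if there is one, up to the translation
  `t_m ↦ t_m + κ`. Modulo `N` the difference integral is invariant under such translations
  (`diffIntegral_shiftHom`), because `[x + κ]_e = [x]_e + κ e [x]_{e-1}` and `N_r (r_m + 1)` is
  divisible by `N`.
* Singularity (`sum_integralAt_insert`). For a set `J` of `l - 1` points, let one variable be free and
  stand between `z_{c-1}` and `z_c`. When it crosses `z_c`, the sum of the products changes by
  `U_{J ∪ {c}}` if `c ∉ J` and does not change if `c ∈ J`. So the coordinate of `e U` at `J` is the
  difference of the sums with the free variable in the last and in the first place, and these differ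
  by a translation of this variable.

The symmetric equations are the exchange and rotation relations read in coordinates. For the `qKZ`
equation with index `a`, the point `z_a` is moved by exchanges to the last place
(`ratCongr_coordAt_right`), by the rotation to the first place, where it becomes `z_a - κ`, and by
exchanges back to the place `a` (`ratCongr_coordAt_left`). If every point keeps its own tensor factor,
each exchange is exactly one factor of `K_a(z; κ)`. The denominators of these factors are not zero
divisors modulo `N`, as a translation takes `z_a - z_b - c` to `z_a`.
-/

noncomputable section

/-! ### Ordered products -/

/-- The factor of an ordered product coming from a variable `t` at position `p` and a point `z` at
position `q`, as a function of `x = t - z`: it is `[x]_k` if `t` stands before `z`,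
`[x]_k (x - κ k) / x = [x - κ]_k` if `t` stands after `z`, and `[x]_k / x = [x - κ]_{k-1}` if `t` is
attached to `z`, which is encoded by `p = q`. -/
def zFactor {B : Type*} [CommRing B] (κ k p q : ℕ) (x : B) : B :=
  if q < p then poch κ k (x - κ) else if q = p then poch κ (k - 1) (x - κ) else poch κ k x

/-- The factor of an ordered product coming from two variables at positions `p` and `q`, the first
one having the smaller index, as a function of their difference `d`: it is `[d + 1]_{k'}` if they
stand in their natural order, and `[d + 1]_{k'} (d + 1 - κ k') / (d + 1) = [d + 1 - κ]_{k'}`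
otherwise. -/
def pairFactor {B : Type*} [CommRing B] (κ k' p q : ℕ) (d : B) : B :=
  if p < q then poch κ k' (d + 1) else poch κ k' (d + 1 - κ)

/-- The product of all factors for pairs of variables at positions `p i`. -/
def pairProd {B : Type*} [CommRing B] {l : ℕ} (κ k' : ℕ) (p : Fin l → ℕ) (t : Fin l → B) : B :=
  ∏ i, ∏ j ∈ Finset.Ioi i, pairFactor κ k' (p i) (p j) (t i - t j)

/-- The ordered product `Φ w` with the variables `t i` at positions `p i` and the points `z a` at
positions `pz a`. It depends on the relative order of the positions only. -/
def orderedTerm {B : Type*} [CommRing B] {l n : ℕ} (κ k k' : ℕ) (p : Fin l → ℕ) (pz : Fin n → ℕ)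
    (t : Fin l → B) (z : Fin n → B) : B :=
  (∏ i, ∏ a, zFactor κ k (p i) (pz a) (t i - z a)) * pairProd κ k' p t

/-- The injective maps from `Fin l` with image `I`: the ways to attach the variables `t i` to the
elements of `I`. -/
def placements (l : ℕ) {X : Type*} [Fintype X] [DecidableEq X] (I : Finset X) :
    Finset (Fin l → X) :=
  Finset.univ.filter fun s => Function.Injective s ∧ Finset.univ.image s = I

/-- The function `U_I` at a point `(t, z)` of an arbitrary commutative ring. -/
def integrandAt {B : Type*} [CommRing B] {l n : ℕ} (κ k k' : ℕ) (t : Fin l → B) (z : Fin n → B)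
    (I : Finset (Fin n)) : B :=
  ∑ s ∈ placements l I, orderedTerm κ k k' (fun i => (s i).val) Fin.val t z

section Basic

variable {B : Type*} [CommRing B] {l n : ℕ}

theorem mem_placements {X : Type*} [Fintype X] [DecidableEq X] {I : Finset X} {s : Fin l → X} :
    s ∈ placements l I ↔ Function.Injective s ∧ Finset.univ.image s = I := by
  simp [placements]

theorem exists_of_mem_placements {X : Type*} [Fintype X] [DecidableEq X] {I : Finset X}
    {s : Fin l → X} (hs : s ∈ placements l I) {x : X} (hx : x ∈ I) : ∃ m, s m = x := by
  rw [← (mem_placements.1 hs).2] at hx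
  simpa using hx

theorem apply_mem_of_mem_placements {X : Type*} [Fintype X] [DecidableEq X] {I : Finset X}
    {s : Fin l → X} (hs : s ∈ placements l I) (i : Fin l) : s i ∈ I := by
  rw [← (mem_placements.1 hs).2]
  simp

theorem comp_mem_placements {X Y : Type*} [Fintype X] [DecidableEq X] [Fintype Y] [DecidableEq Y]
    {I : Finset X} {J : Finset Y} {s : Fin l → X} (hs : s ∈ placements l I) (g : X → Y)
    (hg : Set.InjOn g I) (hJ : I.image g = J) : (g ∘ s) ∈ placements l J := by
  rw [mem_placements] at hs ⊢
  refine ⟨fun i j hij => hs.1 (hg ?_ ?_ hij), by rw [← Finset.image_image, hs.2, hJ]⟩ <;>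
    simp [← hs.2]

/-- Reindexing of placements along an injective map with an explicit inverse. -/
theorem sum_placements_comp {X Y : Type*} [Fintype X] [DecidableEq X] [Fintype Y] [DecidableEq Y]
    {I : Finset X} {J : Finset Y} (g : X → Y) (g' : Y → X) (hg : ∀ x ∈ I, g' (g x) = x)
    (hg' : ∀ y ∈ J, g (g' y) = y) (hI : I.image g = J) {M : Type*} [AddCommMonoid M]
    (f : (Fin l → Y) → M) :
    ∑ s ∈ placements l J, f s = ∑ s ∈ placements l I, f (g ∘ s) := by
  have hJ : J.image g' = I := by
    rw [← hI, Finset.image_image]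
    ext x
    simp only [Finset.mem_image, Function.comp_apply]
    exact ⟨fun ⟨y, hy, h⟩ => by rw [← h, hg y hy]; exact hy, fun hx => ⟨x, hx, hg x hx⟩⟩
  refine Finset.sum_nbij' (fun s => g' ∘ s) (fun s => g ∘ s) ?_ ?_ ?_ ?_ ?_
  · intro s hs
    refine comp_mem_placements hs g' (fun x hx y hy h => ?_) hJ
    rw [← hg' x hx, ← hg' y hy, h]
  · intro s hs
    refine comp_mem_placements hs g (fun x hx y hy h => ?_) hI
    rw [← hg x hx, ← hg y hy, h]
  · intro s hs
    funext i
    exact hg' _ (apply_mem_of_mem_placements hs i)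
  · intro s hs
    funext i
    exact hg _ (apply_mem_of_mem_placements hs i)
  · intro s hs
    congr 1
    funext i
    exact (hg' _ (apply_mem_of_mem_placements hs i)).symm

theorem placements_eq_empty {X : Type*} [Fintype X] [DecidableEq X] {I : Finset X}
    (h : I.card ≠ l) : placements l I = ∅ := by
  refine Finset.eq_empty_of_forall_notMem fun s hs => h ?_
  rw [mem_placements] at hs
  rw [← hs.2, Finset.card_image_of_injective _ hs.1, Finset.card_univ, Fintype.card_fin]

theorem pairProd_congr (κ k' : ℕ) {p p' : Fin l → ℕ}
    (h : ∀ i j, i ≠ j → (p i < p j ↔ p' i < p' j)) (t : Fin l → B) :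
    pairProd κ k' p t = pairProd κ k' p' t := by
  refine Finset.prod_congr rfl fun i _ => Finset.prod_congr rfl fun j hj => ?_
  have hij : i ≠ j := (Finset.mem_Ioi.1 hj).ne
  simp only [pairFactor, h i j hij]

theorem zFactor_congr (κ k : ℕ) {p q p' q' : ℕ} (h1 : q < p ↔ q' < p') (h2 : q = p ↔ q' = p')
    (x : B) : zFactor κ k p q x = zFactor κ k p' q' x := by
  simp only [zFactor, h1, h2]

section Map

variable {C : Type*} [CommRing C] (φ : B →+* C)

theorem map_poch (κ m : ℕ) (x : B) : φ (poch κ m x) = poch κ m (φ x) := by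
  simp [poch, map_prod]

theorem map_zFactor (κ k p q : ℕ) (x : B) : φ (zFactor κ k p q x) = zFactor κ k p q (φ x) := by
  simp only [zFactor, apply_ite φ, map_poch, map_sub, map_natCast]

theorem map_pairFactor (κ k' p q : ℕ) (x : B) :
    φ (pairFactor κ k' p q x) = pairFactor κ k' p q (φ x) := by
  simp only [pairFactor, apply_ite φ, map_poch, map_sub, map_add, map_one, map_natCast]

theorem map_orderedTerm (κ k k' : ℕ) (p : Fin l → ℕ) (pz : Fin n → ℕ) (t : Fin l → B)
    (z : Fin n → B) :
    φ (orderedTerm κ k k' p pz t z)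
      = orderedTerm κ k k' p pz (fun i => φ (t i)) (fun a => φ (z a)) := by
  simp only [orderedTerm, pairProd, map_mul, map_prod, map_zFactor, map_pairFactor, map_sub]

theorem map_integrandAt (κ k k' : ℕ) (t : Fin l → B) (z : Fin n → B) (I : Finset (Fin n)) :
    φ (integrandAt κ k k' t z I)
      = integrandAt κ k k' (fun i => φ (t i)) (fun a => φ (z a)) I := by
  simp only [integrandAt, map_sum, map_orderedTerm]

end Map

theorem poch_succ (κ m : ℕ) (x : B) : poch κ (m + 1) x = x * poch κ m (x - κ) := by
  rw [poch, Finset.prod_range_succ', poch, mul_comm]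
  simp only [Nat.cast_zero, zero_mul, sub_zero]
  congr 1
  refine Finset.prod_congr rfl fun i _ => ?_
  push_cast
  ring

theorem poch_succ_sub (κ m : ℕ) (x : B) :
    poch κ (m + 1) (x - κ) = (x - κ * (m + 1 : ℕ)) * poch κ m (x - κ) := by
  rw [poch, Finset.prod_range_succ, ← poch, mul_comm]
  push_cast
  ring

/-- Moving a variable `t m` from the first to the last place compensates the shift of `t m` by
`κ`. -/
theorem pairProd_update (κ k' : ℕ) {p p' : Fin l → ℕ} (m : Fin l)
    (h1 : ∀ i, i ≠ m → p m < p i) (h2 : ∀ i, i ≠ m → p' i < p' m)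
    (h3 : ∀ i j, i ≠ m → j ≠ m → i ≠ j → (p i < p j ↔ p' i < p' j)) (t : Fin l → B) :
    pairProd κ k' p' (Function.update t m (t m + κ)) = pairProd κ k' p t := by
  refine Finset.prod_congr rfl fun i _ => Finset.prod_congr rfl fun j hj => ?_
  have hij : i ≠ j := (Finset.mem_Ioi.1 hj).ne
  unfold pairFactor
  by_cases him : i = m
  · subst him
    rw [if_neg (by have := h2 j hij.symm; omega), if_pos (h1 j hij.symm), Function.update_self,
      Function.update_of_ne hij.symm]
    congr 1
    ring
  · by_cases hjm : j = m
    · subst hjm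
      rw [if_pos (h2 i hij), if_neg (by have := h1 i hij; omega), Function.update_self,
        Function.update_of_ne hij]
      congr 1
      ring
    · rw [Function.update_of_ne him, Function.update_of_ne hjm]
      simp only [h3 i j him hjm hij]

/-! ### Reduced products -/

/-- The analogue of `zFactor` without the factor `[x - κ]_{k-1}`, for `κ k = -1`. -/
def zRed (p q : ℕ) (x : B) : B := if q < p then x + 1 else if q = p then 1 else x

/-- The analogue of `pairFactor` without the factor `[d + 1 - κ]_{k'-1}`, for `κ k' = 2`. -/
def pairRed (p q : ℕ) (d : B) : B := if p < q then d + 1 else d - 1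

/-- The product of the reduced factors for a variable with value `x` at position `p`. -/
def rowRed (p : ℕ) (pz : Fin n → ℕ) (z : Fin n → B) (x : B) : B := ∏ a, zRed p (pz a) (x - z a)

/-- The product of the reduced factors for pairs of variables. -/
def pairRedProd (p : Fin l → ℕ) (t : Fin l → B) : B :=
  ∏ i, ∏ j ∈ Finset.Ioi i, pairRed (p i) (p j) (t i - t j)

/-- The analogue of `orderedTerm` with reduced factors. -/
def redTerm (p : Fin l → ℕ) (pz : Fin n → ℕ) (t : Fin l → B) (z : Fin n → B) : B :=
  (∏ i, rowRed (p i) pz z (t i)) * pairRedProd p t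

/-- The sum of the reduced products over all placements. -/
def redSum (t : Fin l → B) (z : Fin n → B) (I : Finset (Fin n)) : B :=
  ∑ s ∈ placements l I, redTerm (fun i => (s i).val) Fin.val t z

/-- The common factor of all ordered products when `κ k = -1` and `κ k' = 2`. -/
def commonFactor (κ k k' : ℕ) (t : Fin l → B) (z : Fin n → B) : B :=
  (∏ i, ∏ a, poch κ (k - 1) (t i - z a - κ)) *
    ∏ i, ∏ j ∈ Finset.Ioi i, poch κ (k' - 1) (t i - t j + 1 - κ)

theorem orderedTerm_eq {κ k k' : ℕ} (hk : 0 < k) (hk' : 0 < k') (h : (κ : B) * k = -1)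
    (h' : (κ : B) * k' = 2) (p : Fin l → ℕ) (pz : Fin n → ℕ) (t : Fin l → B) (z : Fin n → B) :
    orderedTerm κ k k' p pz t z = commonFactor κ k k' t z * redTerm p pz t z := by
  obtain ⟨k, rfl⟩ : ∃ j, k = j + 1 := ⟨k - 1, by omega⟩
  obtain ⟨k', rfl⟩ : ∃ j, k' = j + 1 := ⟨k' - 1, by omega⟩
  have hz : ∀ (p q : ℕ) (x : B),
      zFactor κ (k + 1) p q x = poch κ k (x - κ) * zRed p q x := by
    intro p q x
    unfold zFactor zRed
    split_ifs
    · rw [poch_succ_sub, h]; ring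
    · simp
    · rw [poch_succ]; ring
  have hd : ∀ (p q : ℕ) (d : B),
      pairFactor κ (k' + 1) p q d = poch κ k' (d + 1 - κ) * pairRed p q d := by
    intro p q d
    unfold pairFactor pairRed
    split_ifs
    · rw [poch_succ]; ring
    · rw [poch_succ_sub, h']; ring
  simp only [orderedTerm, pairProd, commonFactor, redTerm, rowRed, pairRedProd, hz, hd,
    Finset.prod_mul_distrib, Nat.add_sub_cancel]
  ring

theorem integrandAt_eq {κ k k' : ℕ} (hk : 0 < k) (hk' : 0 < k') (h : (κ : B) * k = -1)
    (h' : (κ : B) * k' = 2) (t : Fin l → B) (z : Fin n → B) (I : Finset (Fin n)) :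
    integrandAt κ k k' t z I = commonFactor κ k k' t z * redSum t z I := by
  simp only [integrandAt, redSum, Finset.mul_sum, orderedTerm_eq hk hk' h h']

theorem commonFactor_perm (κ k k' : ℕ) (t : Fin l → B) (z : Fin n → B)
    (σ : Equiv.Perm (Fin n)) : commonFactor κ k k' t (z ∘ σ) = commonFactor κ k k' t z := by
  unfold commonFactor
  congr 1
  refine Finset.prod_congr rfl fun i _ => ?_
  exact Equiv.prod_comp σ fun a => poch κ (k - 1) (t i - z a - κ)

theorem pairRedProd_congr {p p' : Fin l → ℕ}
    (h : ∀ i j, i ≠ j → (p i < p j ↔ p' i < p' j)) (t : Fin l → B) :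
    pairRedProd p t = pairRedProd p' t := by
  refine Finset.prod_congr rfl fun i _ => Finset.prod_congr rfl fun j hj => ?_
  have hij : i ≠ j := (Finset.mem_Ioi.1 hj).ne
  simp only [pairRed, h i j hij]

/-- Exchanging two variables in neighbouring places changes the factor of this pair only. -/
theorem pairRedProd_exchange {p p' : Fin l → ℕ} {m m' : Fin l} (hm : m ≠ m') (h1 : p m < p m')
    (h2 : p' m' < p' m)
    (h : ∀ i j, i ≠ j → ¬(i = m ∧ j = m') → ¬(i = m' ∧ j = m) → (p i < p j ↔ p' i < p' j))
    (t : Fin l → B) :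
    ∃ W, pairRedProd p t = (t m - t m' + 1) * W ∧ pairRedProd p' t = (t m - t m' - 1) * W := by
  have hprod : ∀ p : Fin l → ℕ, pairRedProd p t =
      ∏ x ∈ Finset.univ.filter (fun x : Fin l × Fin l => x.1 < x.2),
        pairRed (p x.1) (p x.2) (t x.1 - t x.2) := by
    intro p
    rw [Finset.prod_filter, Fintype.prod_prod_type, pairRedProd]
    refine Finset.prod_congr rfl fun i _ => ?_
    rw [← Finset.prod_filter]
    refine Finset.prod_congr ?_ fun _ _ => rfl
    ext j
    simp
  have hrest : ∀ y : Fin l × Fin l, (y = (m, m') ∨ y = (m', m)) → y.1 < y.2 →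
      ∏ x ∈ (Finset.univ.filter (fun x : Fin l × Fin l => x.1 < x.2)).erase y,
        pairRed (p x.1) (p x.2) (t x.1 - t x.2) =
      ∏ x ∈ (Finset.univ.filter (fun x : Fin l × Fin l => x.1 < x.2)).erase y,
        pairRed (p' x.1) (p' x.2) (t x.1 - t x.2) := by
    intro y hy hlt
    refine Finset.prod_congr rfl fun x hx => ?_
    simp only [Finset.mem_erase, Finset.mem_filter, Finset.mem_univ, true_and] at hx
    have := h x.1 x.2 hx.2.ne ?_ ?_
    · simp only [pairRed, this]
    · rintro ⟨e1, e2⟩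
      rcases hy with rfl | rfl
      · exact hx.1 (Prod.ext e1 e2)
      · rw [e1, e2] at hx; exact absurd hx.2 (not_lt.2 hlt.le)
    · rintro ⟨e1, e2⟩
      rcases hy with rfl | rfl
      · rw [e1, e2] at hx; exact absurd hx.2 (not_lt.2 hlt.le)
      · exact hx.1 (Prod.ext e1 e2)
  rw [hprod p, hprod p']
  rcases lt_or_gt_of_ne hm with hlt | hlt
  · have hmem : (m, m') ∈ Finset.univ.filter (fun x : Fin l × Fin l => x.1 < x.2) := by simpa
    rw [← Finset.mul_prod_erase _ _ hmem, ← Finset.mul_prod_erase _ _ hmem,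
      ← hrest _ (Or.inl rfl) hlt]
    refine ⟨∏ x ∈ (Finset.univ.filter (fun x : Fin l × Fin l => x.1 < x.2)).erase (m, m'),
        pairRed (p x.1) (p x.2) (t x.1 - t x.2), ?_, ?_⟩
    · simp only [pairRed, if_pos h1]
    · simp only [pairRed, if_neg (not_lt.2 h2.le)]
  · have hmem : (m', m) ∈ Finset.univ.filter (fun x : Fin l × Fin l => x.1 < x.2) := by simpa
    rw [← Finset.mul_prod_erase _ _ hmem, ← Finset.mul_prod_erase _ _ hmem,
      ← hrest _ (Or.inr rfl) hlt]
    refine ⟨-∏ x ∈ (Finset.univ.filter (fun x : Fin l × Fin l => x.1 < x.2)).erase (m', m),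
        pairRed (p x.1) (p x.2) (t x.1 - t x.2), ?_, ?_⟩
    · simp only [pairRed, if_neg (not_lt.2 h1.le)]; ring
    · simp only [pairRed, if_pos h2]; ring

end Basic

/-! ### Exchange of neighbouring points -/

section Exchange

variable {B : Type*} [CommRing B] {l n : ℕ}

theorem swap_val_lt_iff {a b : Fin n} (hab : a.val + 1 = b.val) {c d : Fin n}
    (h : ¬(c = a ∧ d = b)) (h' : ¬(c = b ∧ d = a)) :
    (Equiv.swap a b c).val < (Equiv.swap a b d).val ↔ c.val < d.val := by
  simp only [Fin.ext_iff] at h h'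
  simp only [Equiv.swap_apply_def, Fin.ext_iff]
  split_ifs <;> omega

theorem rowRed_swap_of_ne {a b : Fin n} (hab : a.val + 1 = b.val) {c : Fin n} (ha : c ≠ a)
    (hb : c ≠ b) (z : Fin n → B) (x : B) :
    rowRed c.val Fin.val (z ∘ Equiv.swap a b) x = rowRed c.val Fin.val z x := by
  unfold rowRed
  rw [← Equiv.prod_comp (Equiv.swap a b)]
  refine Finset.prod_congr rfl fun d _ => ?_
  simp only [Function.comp_apply, Equiv.swap_apply_self]
  have hc : Equiv.swap a b c = c := Equiv.swap_apply_of_ne_of_ne ha hb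
  have h1 := swap_val_lt_iff hab (c := d) (d := c) (fun h => hb h.2) (fun h => ha h.2)
  have h2 : (Equiv.swap a b d).val = c.val ↔ d.val = c.val := by
    rw [← Fin.ext_iff, ← Fin.ext_iff, ← (Equiv.swap a b).injective.eq_iff (a := d), hc]
  rw [hc] at h1
  simp only [zRed, h1, h2]

theorem rowRed_neighbours {a b : Fin n} (hab : a.val + 1 = b.val) (z : Fin n → B) (x : B) :
    ∃ H : B, rowRed a.val Fin.val z x = H * (x - z b) ∧
      rowRed b.val Fin.val z x = H * (x - z a + 1) ∧
      rowRed a.val Fin.val (z ∘ Equiv.swap a b) x = H * (x - z a) ∧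
      rowRed b.val Fin.val (z ∘ Equiv.swap a b) x = H * (x - z b + 1) := by
  have hne : b ≠ a := by rintro rfl; omega
  have hex : ∀ f : Fin n → B, ∏ d, f d = f a * (f b * ∏ d ∈ (Finset.univ.erase a).erase b, f d) := by
    intro f
    rw [← Finset.mul_prod_erase _ _ (Finset.mem_univ a),
      ← Finset.mul_prod_erase _ _ (Finset.mem_erase.2 ⟨hne, Finset.mem_univ b⟩)]
  refine ⟨∏ d ∈ (Finset.univ.erase a).erase b, zRed a.val d.val (x - z d), ?_, ?_, ?_, ?_⟩ <;>
    unfold rowRed <;> rw [hex]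
  · simp only [zRed, lt_irrefl, if_false, if_true]
    rw [if_neg (by omega), if_neg (by omega)]
    ring
  · have h : ∏ d ∈ (Finset.univ.erase a).erase b, zRed b.val d.val (x - z d) =
        ∏ d ∈ (Finset.univ.erase a).erase b, zRed a.val d.val (x - z d) := by
      refine Finset.prod_congr rfl fun d hd => ?_
      simp only [Finset.mem_erase, ne_eq, Fin.ext_iff] at hd
      have h1 : d.val < b.val ↔ d.val < a.val := by omega
      have h2 : d.val = b.val ↔ d.val = a.val := by omega
      simp only [zRed, h1, h2]
    rw [h]
    simp only [zRed, lt_irrefl, if_false, if_true]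
    rw [if_pos (by omega)]
    ring
  · have h : ∏ d ∈ (Finset.univ.erase a).erase b,
          zRed a.val d.val (x - (z ∘ Equiv.swap a b) d) =
        ∏ d ∈ (Finset.univ.erase a).erase b, zRed a.val d.val (x - z d) := by
      refine Finset.prod_congr rfl fun d hd => ?_
      simp only [Finset.mem_erase] at hd
      rw [Function.comp_apply, Equiv.swap_apply_of_ne_of_ne hd.2.1 hd.1]
    rw [h]
    simp only [zRed, lt_irrefl, if_false, if_true, Function.comp_apply, Equiv.swap_apply_right]
    rw [if_neg (by omega), if_neg (by omega)]
    ring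
  · have h : ∏ d ∈ (Finset.univ.erase a).erase b,
          zRed b.val d.val (x - (z ∘ Equiv.swap a b) d) =
        ∏ d ∈ (Finset.univ.erase a).erase b, zRed a.val d.val (x - z d) := by
      refine Finset.prod_congr rfl fun d hd => ?_
      simp only [Finset.mem_erase, ne_eq] at hd
      rw [Function.comp_apply, Equiv.swap_apply_of_ne_of_ne hd.2.1 hd.1]
      simp only [Fin.ext_iff] at hd
      have h1 : d.val < b.val ↔ d.val < a.val := by omega
      have h2 : d.val = b.val ↔ d.val = a.val := by omega
      simp only [zRed, h1, h2]
    rw [h]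
    simp only [zRed, lt_irrefl, if_false, if_true, Function.comp_apply, Equiv.swap_apply_left]
    rw [if_pos (by omega)]
    ring

theorem sum_placements_swap {X : Type*} [Fintype X] [DecidableEq X] (a b : X) (I : Finset X)
    {M : Type*} [AddCommMonoid M] (f : (Fin l → X) → M) :
    ∑ s ∈ placements l (I.image (Equiv.swap a b)), f s =
      ∑ s ∈ placements l I, f (Equiv.swap a b ∘ s) :=
  sum_placements_comp _ (Equiv.swap a b) (fun _ _ => Equiv.swap_apply_self _ _ _)
    (fun _ _ => Equiv.swap_apply_self _ _ _) rfl f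

theorem image_swap_of_mem {X : Type*} [DecidableEq X] {a b : X} {I : Finset X} (h : a ∈ I ↔ b ∈ I) :
    I.image (Equiv.swap a b) = I := by
  ext c
  simp only [Finset.mem_image]
  have key : ∀ d, d ∈ I ↔ Equiv.swap a b d ∈ I := by
    intro d
    rw [Equiv.swap_apply_def]
    split_ifs with h1 h2
    · rw [h1, h]
    · rw [h2, h]
    · rfl
  constructor
  · rintro ⟨d, hd, rfl⟩
    exact (key d).1 hd
  · intro hc
    exact ⟨_, (key c).1 hc, Equiv.swap_apply_self _ _ _⟩

theorem pairRedProd_swap {a b : Fin n} (hab : a.val + 1 = b.val) {s : Fin l → Fin n}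
    (h : ¬((∃ i, s i = a) ∧ ∃ i, s i = b)) (t : Fin l → B) :
    pairRedProd (fun i => ((Equiv.swap a b ∘ s) i).val) t = pairRedProd (fun i => (s i).val) t := by
  refine pairRedProd_congr (fun i j _ => swap_val_lt_iff hab ?_ ?_) t
  · exact fun h' => h ⟨⟨i, h'.1⟩, ⟨j, h'.2⟩⟩
  · exact fun h' => h ⟨⟨j, h'.2⟩, ⟨i, h'.1⟩⟩

/-- If exactly one of two neighbouring points is occupied, the exchange relation holds for every
placement, because the factors for the variable attached to it satisfy it. -/
theorem redTerm_swap_of_one {a b : Fin n} (hab : a.val + 1 = b.val) {s : Fin l → Fin n}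
    (hs : Function.Injective s) {m : Fin l} (hm : s m = a ∧ (∀ i, s i ≠ b) ∨ s m = b ∧ ∀ i, s i ≠ a)
    (t : Fin l → B) (z : Fin n → B) :
    (z a - z b - 1) * redTerm (fun i => (s i).val) Fin.val t (z ∘ Equiv.swap a b) =
      (z a - z b) * redTerm (fun i => ((Equiv.swap a b ∘ s) i).val) Fin.val t z -
        redTerm (fun i => (s i).val) Fin.val t z := by
  have hpair := pairRedProd_swap hab (s := s) (by
    rintro ⟨⟨i, hi⟩, j, hj⟩
    rcases hm with h | h
    · exact h.2 j hj
    · exact h.2 i hi) t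
  have hne : ∀ i, i ≠ m → s i ≠ a ∧ s i ≠ b := by
    intro i hi
    have h0 : s i ≠ s m := fun h => hi (hs h)
    rcases hm with h | h
    · exact ⟨h.1 ▸ h0, h.2 i⟩
    · exact ⟨h.2 i, h.1 ▸ h0⟩
  unfold redTerm
  rw [hpair]
  rw [← Finset.mul_prod_erase _ _ (Finset.mem_univ m),
    ← Finset.mul_prod_erase _ (fun i => rowRed ((Equiv.swap a b ∘ s) i).val Fin.val z (t i))
      (Finset.mem_univ m),
    ← Finset.mul_prod_erase _ (fun i => rowRed (s i).val Fin.val z (t i)) (Finset.mem_univ m)]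
  have h1 : ∏ i ∈ Finset.univ.erase m, rowRed (s i).val Fin.val (z ∘ Equiv.swap a b) (t i) =
      ∏ i ∈ Finset.univ.erase m, rowRed (s i).val Fin.val z (t i) := by
    refine Finset.prod_congr rfl fun i hi => ?_
    have := hne i (Finset.ne_of_mem_erase hi)
    exact rowRed_swap_of_ne hab this.1 this.2 z (t i)
  have h2 : ∏ i ∈ Finset.univ.erase m, rowRed ((Equiv.swap a b ∘ s) i).val Fin.val z (t i) =
      ∏ i ∈ Finset.univ.erase m, rowRed (s i).val Fin.val z (t i) := by
    refine Finset.prod_congr rfl fun i hi => ?_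
    have := hne i (Finset.ne_of_mem_erase hi)
    rw [Function.comp_apply, Equiv.swap_apply_of_ne_of_ne this.1 this.2]
  rw [h1, h2]
  beta_reduce
  obtain ⟨H, e1, e2, e3, e4⟩ := rowRed_neighbours hab z (t m)
  rcases hm with h | h
  · rw [Function.comp_apply, h.1, Equiv.swap_apply_left, e1, e2, e3]
    ring
  · rw [Function.comp_apply, h.1, Equiv.swap_apply_right, e1, e2, e4]
    ring

/-- If two neighbouring points are both occupied, exchanging their values preserves the sum of the
terms of a placement and of the one obtained by exchanging the two attached variables. -/
theorem redTerm_swap_of_both {a b : Fin n} (hab : a.val + 1 = b.val) {s : Fin l → Fin n}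
    (hs : Function.Injective s) {m m' : Fin l} (hm : s m = a) (hm' : s m' = b)
    (t : Fin l → B) (z : Fin n → B) :
    redTerm (fun i => (s i).val) Fin.val t (z ∘ Equiv.swap a b) +
      redTerm (fun i => ((Equiv.swap a b ∘ s) i).val) Fin.val t (z ∘ Equiv.swap a b) =
    redTerm (fun i => (s i).val) Fin.val t z +
      redTerm (fun i => ((Equiv.swap a b ∘ s) i).val) Fin.val t z := by
  have hne : m ≠ m' := by rintro rfl; rw [hm] at hm'; rw [hm'] at hab; omega
  obtain ⟨W, hW1, hW2⟩ := pairRedProd_exchange (p := fun i => (s i).val)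
    (p' := fun i => ((Equiv.swap a b ∘ s) i).val) hne
    (by simp only [hm, hm']; omega)
    (by simp only [Function.comp_apply, hm, hm', Equiv.swap_apply_left, Equiv.swap_apply_right]
        omega)
    (fun i j _ h1 h2 => (swap_val_lt_iff hab
      (fun h => h1 ⟨hs (h.1.trans hm.symm), hs (h.2.trans hm'.symm)⟩)
      (fun h => h2 ⟨hs (h.1.trans hm'.symm), hs (h.2.trans hm.symm)⟩)).symm) t
  have hex : ∀ f : Fin l → B,
      ∏ i, f i = f m * (f m' * ∏ i ∈ (Finset.univ.erase m).erase m', f i) := by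
    intro f
    rw [← Finset.mul_prod_erase _ _ (Finset.mem_univ m),
      ← Finset.mul_prod_erase _ _ (Finset.mem_erase.2 ⟨hne.symm, Finset.mem_univ m'⟩)]
  have hrest : ∀ i ∈ (Finset.univ.erase m).erase m', s i ≠ a ∧ s i ≠ b := by
    intro i hi
    simp only [Finset.mem_erase] at hi
    exact ⟨fun h => hi.2.1 (hs (h.trans hm.symm)), fun h => hi.1 (hs (h.trans hm'.symm))⟩
  have h1 : ∀ z' : Fin n → B, ∏ i ∈ (Finset.univ.erase m).erase m',
        rowRed ((Equiv.swap a b ∘ s) i).val Fin.val z' (t i) =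
      ∏ i ∈ (Finset.univ.erase m).erase m', rowRed (s i).val Fin.val z' (t i) := by
    intro z'
    refine Finset.prod_congr rfl fun i hi => ?_
    rw [Function.comp_apply, Equiv.swap_apply_of_ne_of_ne (hrest i hi).1 (hrest i hi).2]
  have h2 : ∏ i ∈ (Finset.univ.erase m).erase m',
        rowRed (s i).val Fin.val (z ∘ Equiv.swap a b) (t i) =
      ∏ i ∈ (Finset.univ.erase m).erase m', rowRed (s i).val Fin.val z (t i) :=
    Finset.prod_congr rfl fun i hi =>
      rowRed_swap_of_ne hab (hrest i hi).1 (hrest i hi).2 z (t i)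
  unfold redTerm
  rw [hW1, hW2]
  simp only [hex, h1, h2]
  simp only [Function.comp_apply (f := Equiv.swap a b), hm, hm', Equiv.swap_apply_left,
    Equiv.swap_apply_right]
  obtain ⟨H, e1, e2, e3, e4⟩ := rowRed_neighbours hab z (t m)
  obtain ⟨H', e1', e2', e3', e4'⟩ := rowRed_neighbours hab z (t m')
  rw [e1, e2, e3, e4, e1', e2', e3', e4']
  ring

/-- The exchange relation for the reduced sums: the action of `u P - 1` on the coordinates, with
`u = z_a - z_b`. -/
theorem redSum_swap {a b : Fin n} (hab : a.val + 1 = b.val) (t : Fin l → B) (z : Fin n → B)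
    (I : Finset (Fin n)) :
    (z a - z b - 1) * redSum t (z ∘ Equiv.swap a b) I =
      (z a - z b) * redSum t z (I.image (Equiv.swap a b)) - redSum t z I := by
  by_cases hI : a ∈ I ↔ b ∈ I
  · rw [image_swap_of_mem hI]
    suffices h : redSum t (z ∘ Equiv.swap a b) I = redSum t z I by rw [h]; ring
    by_cases ha : a ∈ I
    · have hb := hI.1 ha
      have hinv : ∀ f : (Fin l → Fin n) → B,
          ∑ s ∈ placements l I, f s = ∑ s ∈ placements l I, f (Equiv.swap a b ∘ s) := by
        intro f
        rw [← sum_placements_swap, image_swap_of_mem hI]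
      rw [← sub_eq_zero]
      simp only [redSum, ← Finset.sum_sub_distrib]
      refine Finset.sum_involution (fun s _ => Equiv.swap a b ∘ s) ?_ ?_ ?_ ?_
      · intro s hs
        obtain ⟨m, hm⟩ := exists_of_mem_placements hs ha
        obtain ⟨m', hm'⟩ := exists_of_mem_placements hs hb
        have := redTerm_swap_of_both hab (mem_placements.1 hs).1 hm hm' t z
        linear_combination this
      · intro s hs _ h
        obtain ⟨m, hm⟩ := exists_of_mem_placements hs ha
        have := congrFun h m
        rw [Function.comp_apply, hm, Equiv.swap_apply_left] at this
        rw [this] at hab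
        omega
      · intro s hs
        exact comp_mem_placements hs _ (Equiv.injective _).injOn (image_swap_of_mem hI)
      · intro s hs
        funext i
        simp
    · have hb : b ∉ I := fun h => ha (hI.2 h)
      refine Finset.sum_congr rfl fun s hs => ?_
      unfold redTerm
      congr 1
      refine Finset.prod_congr rfl fun i _ => ?_
      have := apply_mem_of_mem_placements hs i
      exact rowRed_swap_of_ne hab (fun h => ha (h ▸ this)) (fun h => hb (h ▸ this)) z (t i)
  · unfold redSum
    rw [sum_placements_swap, Finset.mul_sum, Finset.mul_sum, ← Finset.sum_sub_distrib]
    refine Finset.sum_congr rfl fun s hs => ?_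
    have hmem := apply_mem_of_mem_placements hs
    by_cases ha : a ∈ I
    · have hb : b ∉ I := fun h => hI ⟨fun _ => h, fun _ => ha⟩
      obtain ⟨m, hm⟩ := exists_of_mem_placements hs ha
      exact redTerm_swap_of_one hab (mem_placements.1 hs).1
        (Or.inl ⟨hm, fun i h => hb (h ▸ hmem i)⟩) t z
    · have hb : b ∈ I := by by_contra hb; exact hI ⟨fun h => absurd h ha, fun h => absurd h hb⟩
      obtain ⟨m, hm⟩ := exists_of_mem_placements hs hb
      exact redTerm_swap_of_one hab (mem_placements.1 hs).1
        (Or.inr ⟨hm, fun i h => ha (h ▸ hmem i)⟩) t z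

end Exchange

/-! ### Free variables and the singular vector relation -/

section Free

variable {B : Type*} [CommRing B] {l n : ℕ}

/-- The positions of the points `z a`, leaving gaps for a free variable. -/
def zPos (a : Fin n) : ℕ := 2 * a.val + 1

/-- The position of a variable with label `x`: next to `z a` for `x = some a`, and between
`z (c - 1)` and `z c` for the free variable, which has the label `none`. -/
def optPos (c : ℕ) (x : Option (Fin n)) : ℕ := x.elim (2 * c) zPos

/-- The sum of the reduced products in which one variable is free and stands before `z c`, and
the others are attached to the points of `J`. -/
def freeSum (c : ℕ) (t : Fin l → B) (z : Fin n → B) (J : Finset (Fin n)) : B :=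
  ∑ s ∈ placements l (Finset.insertNone J), redTerm (fun i => optPos c (s i)) zPos t z

theorem rowRed_zPos (a : Fin n) (z : Fin n → B) (x : B) :
    rowRed (zPos a) zPos z x = rowRed a.val Fin.val z x := by
  refine Finset.prod_congr rfl fun d _ => ?_
  have h1 : zPos d < zPos a ↔ d.val < a.val := by unfold zPos; omega
  have h2 : zPos d = zPos a ↔ d.val = a.val := by unfold zPos; omega
  simp only [zRed, h1, h2]

theorem rowRed_free (c : Fin n) (z : Fin n → B) (x : B) :
    rowRed (2 * (c.val + 1)) zPos z x = rowRed c.val Fin.val z x * (x - z c + 1) ∧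
      rowRed (2 * c.val) zPos z x = rowRed c.val Fin.val z x * (x - z c) := by
  have h0 : rowRed c.val Fin.val z x =
      ∏ d ∈ Finset.univ.erase c, zRed c.val d.val (x - z d) := by
    unfold rowRed
    rw [← Finset.mul_prod_erase _ _ (Finset.mem_univ c)]
    simp [zRed]
  have hrest : ∀ p, (p = 2 * (c.val + 1) ∨ p = 2 * c.val) →
      ∏ d ∈ Finset.univ.erase c, zRed p (zPos d) (x - z d) =
        ∏ d ∈ Finset.univ.erase c, zRed c.val d.val (x - z d) := by
    intro p hp
    refine Finset.prod_congr rfl fun d hd => ?_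
    have hd' := Finset.ne_of_mem_erase hd
    rw [ne_eq, Fin.ext_iff] at hd'
    have h1 : zPos d < p ↔ d.val < c.val := by unfold zPos; omega
    have h2 : zPos d = p ↔ d.val = c.val := by unfold zPos; omega
    simp only [zRed, h1, h2]
  constructor
  · rw [h0, ← hrest _ (Or.inl rfl), rowRed, ← Finset.mul_prod_erase _ _ (Finset.mem_univ c), mul_comm,
      zRed, if_pos (by unfold zPos; omega)]
  · rw [h0, ← hrest _ (Or.inr rfl), rowRed, ← Finset.mul_prod_erase _ _ (Finset.mem_univ c), mul_comm,
      zRed, if_neg (by unfold zPos; omega), if_neg (by unfold zPos; omega)]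

/-- Moving the free variable across an unoccupied point attaches it to this point. -/
theorem freeSum_succ_of_notMem (t : Fin l → B) (z : Fin n → B) {J : Finset (Fin n)} {c : Fin n}
    (hc : c ∉ J) :
    freeSum (c.val + 1) t z J - freeSum c.val t z J = redSum t z (insert c J) := by
  have himg : (Finset.insertNone J).image (fun x => x.getD c) = insert c J := by
    ext d
    simp only [Finset.mem_image, Finset.mem_insert]
    constructor
    · rintro ⟨x, hx, rfl⟩
      cases x with
      | none => left; rfl
      | some a => right; simpa using hx
    · rintro (rfl | hd)
      · exact ⟨none, by simp, rfl⟩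
      · exact ⟨some d, by simpa using hd, rfl⟩
  have hne : ∀ x ∈ Finset.insertNone J, x ≠ some c := by
    rintro x hx rfl
    exact hc (by simpa using hx)
  unfold redSum freeSum
  rw [sum_placements_comp (I := Finset.insertNone J) (fun x => x.getD c)
    (fun a => if a = c then none else some a) ?_ ?_ himg, ← Finset.sum_sub_distrib]
  · refine Finset.sum_congr rfl fun s hs => ?_
    obtain ⟨m, hm⟩ := exists_of_mem_placements hs (x := none) (by simp)
    have hs' : ∀ i, s i ≠ some c := fun i => hne _ (apply_mem_of_mem_placements hs i)
    have hcmp : ∀ e, (e = c.val + 1 ∨ e = c.val) → ∀ i j, i ≠ j →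
        (optPos e (s i) < optPos e (s j) ↔
          (((fun x : Option (Fin n) => x.getD c) ∘ s) i).val <
            (((fun x : Option (Fin n) => x.getD c) ∘ s) j).val) := by
      intro e he i j _
      have hi := hs' i
      have hj := hs' j
      simp only [Function.comp_apply]
      generalize s i = x at hi ⊢
      generalize s j = y at hj ⊢
      cases x <;> cases y <;>
        simp only [optPos, Option.elim, Option.getD, zPos, ne_eq, Option.some.injEq, Fin.ext_iff]
          at hi hj ⊢ <;> omega
    unfold redTerm
    rw [pairRedProd_congr (hcmp _ (Or.inl rfl)), pairRedProd_congr (hcmp _ (Or.inr rfl)), ← sub_mul]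
    congr 1
    simp only [← Finset.mul_prod_erase _ _ (Finset.mem_univ m)]
    have hrest : ∀ e, ∏ i ∈ Finset.univ.erase m, rowRed (optPos e (s i)) zPos z (t i) =
        ∏ i ∈ Finset.univ.erase m,
          rowRed (((fun x : Option (Fin n) => x.getD c) ∘ s) i).val Fin.val z (t i) := by
      intro e
      refine Finset.prod_congr rfl fun i hi => ?_
      have hi' : s i ≠ none := fun h =>
        Finset.ne_of_mem_erase hi ((mem_placements.1 hs).1 (h.trans hm.symm))
      obtain ⟨a, ha⟩ := Option.ne_none_iff_exists'.1 hi'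
      simp only [Function.comp_apply, ha]
      exact rowRed_zPos a z (t i)
    rw [hrest, hrest]
    simp only [Function.comp_apply, hm, optPos, Option.elim, Option.getD]
    rw [(rowRed_free c z (t m)).1, (rowRed_free c z (t m)).2]
    ring
  · intro x hx
    cases x with
    | none => simp
    | some a =>
      have := hne _ hx
      simp only [ne_eq, Option.some.injEq] at this
      simp [this]
  · intro a _
    by_cases h : a = c
    · simp [h]
    · simp [h]

/-- Moving the free variable across an occupied point does not change the sum: the contributions
of a placement and of the one obtained by exchanging the free variable with the attached one
cancel. -/
theorem freeSum_succ_of_mem (t : Fin l → B) (z : Fin n → B) {J : Finset (Fin n)} {c : Fin n}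
    (hc : c ∈ J) : freeSum (c.val + 1) t z J - freeSum c.val t z J = 0 := by
  unfold freeSum
  rw [← Finset.sum_sub_distrib]
  refine Finset.sum_involution (fun s _ => Equiv.swap none (some c) ∘ s) ?_ ?_ ?_ ?_
  · intro s hs
    obtain ⟨m, hm⟩ := exists_of_mem_placements hs (x := none) (by simp)
    obtain ⟨m', hm'⟩ := exists_of_mem_placements hs (x := some c) (by simpa using hc)
    have hinj := (mem_placements.1 hs).1
    have hne : m ≠ m' := by rintro rfl; simp [hm] at hm'
    have hother : ∀ i, i ≠ m → i ≠ m' → ∃ a, s i = some a ∧ a ≠ c := by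
      intro i hi hi'
      obtain ⟨a, ha⟩ := Option.ne_none_iff_exists'.1 (fun h => hi (hinj (h.trans hm.symm)))
      exact ⟨a, ha, by rintro rfl; exact hi' (hinj (ha.trans hm'.symm))⟩
    have hsw : ∀ i, i ≠ m → i ≠ m' → Equiv.swap none (some c) (s i) = s i := by
      intro i hi hi'
      exact Equiv.swap_apply_of_ne_of_ne (fun h => hi (hinj (h.trans hm.symm)))
        (fun h => hi' (hinj (h.trans hm'.symm)))
    -- the positions of the two variables in question, before and after the exchange
    have hmc : ∀ e, optPos e (s m) = 2 * e := by intro e; rw [hm]; rfl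
    have hmc' : ∀ e, optPos e (s m') = 2 * c.val + 1 := by intro e; rw [hm']; rfl
    have hmd : ∀ e, optPos e (Equiv.swap none (some c) (s m)) = 2 * c.val + 1 := by
      intro e; rw [hm, Equiv.swap_apply_left]; rfl
    have hmd' : ∀ e, optPos e (Equiv.swap none (some c) (s m')) = 2 * e := by
      intro e; rw [hm', Equiv.swap_apply_right]; rfl
    have hoth : ∀ i, i ≠ m → i ≠ m' → ∃ q, q ≠ c.val ∧ ∀ e, optPos e (s i) = 2 * q + 1 ∧
        optPos e (Equiv.swap none (some c) (s i)) = 2 * q + 1 := by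
      intro i hi hi'
      obtain ⟨a, ha, hac⟩ := hother i hi hi'
      refine ⟨a.val, fun h => hac (Fin.ext h), fun e => ?_⟩
      rw [hsw i hi hi', ha]
      exact ⟨rfl, rfl⟩
    have hpos : ∀ i, (i = m ∧ i ≠ m') ∨ (i = m' ∧ i ≠ m) ∨ (i ≠ m ∧ i ≠ m') := by
      intro i
      by_cases h : i = m
      · left; exact ⟨h, h ▸ hne⟩
      · by_cases h' : i = m'
        · right; left; exact ⟨h', h⟩
        · right; right; exact ⟨h, h'⟩
    obtain ⟨W, hW1, hW2⟩ := pairRedProd_exchange (p := fun i => optPos c.val (s i))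
      (p' := fun i => optPos (c.val + 1) (s i)) hne
      (by simp only [hmc, hmc']; omega) (by simp only [hmc, hmc']; omega)
      (by
        intro i j hij h1 h2
        rcases hpos i with hi | hi | hi <;> rcases hpos j with hj | hj | hj
        · exact absurd (hi.1.trans hj.1.symm) hij
        · exact absurd ⟨hi.1, hj.1⟩ h1
        · obtain ⟨q, hq, e⟩ := hoth j hj.1 hj.2
          simp only [hi.1, hmc, (e _).1]; omega
        · exact absurd ⟨hi.1, hj.1⟩ h2
        · exact absurd (hi.1.trans hj.1.symm) hij
        · simp only [hi.1, hmc']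
          obtain ⟨q, hq, e⟩ := hoth j hj.1 hj.2
          simp only [(e _).1]
        · obtain ⟨q, hq, e⟩ := hoth i hi.1 hi.2
          simp only [hj.1, hmc, (e _).1]; omega
        · simp only [hj.1, hmc']
          obtain ⟨q, hq, e⟩ := hoth i hi.1 hi.2
          simp only [(e _).1]
        · obtain ⟨q, hq, e⟩ := hoth i hi.1 hi.2
          obtain ⟨q', hq', e'⟩ := hoth j hj.1 hj.2
          simp only [(e _).1, (e' _).1]) t
    have hcongr : ∀ e e', (e = c.val ∧ e' = c.val + 1 ∨ e = c.val + 1 ∧ e' = c.val) →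
        pairRedProd (fun i => optPos e ((Equiv.swap none (some c) ∘ s) i)) t =
          pairRedProd (fun i => optPos e' (s i)) t := by
      intro e e' hee
      refine pairRedProd_congr (fun i j hij => ?_) t
      simp only [Function.comp_apply]
      rcases hpos i with hi | hi | hi <;> rcases hpos j with hj | hj | hj
      · exact absurd (hi.1.trans hj.1.symm) hij
      · simp only [hi.1, hj.1, hmc, hmc', hmd, hmd']; omega
      · obtain ⟨q, hq, f⟩ := hoth j hj.1 hj.2
        simp only [hi.1, hmc, hmd, (f _).1, (f _).2]; omega
      · simp only [hi.1, hj.1, hmc, hmc', hmd, hmd']; omega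
      · exact absurd (hi.1.trans hj.1.symm) hij
      · obtain ⟨q, hq, f⟩ := hoth j hj.1 hj.2
        simp only [hi.1, hmc', hmd', (f _).1, (f _).2]; omega
      · obtain ⟨q, hq, f⟩ := hoth i hi.1 hi.2
        simp only [hj.1, hmc, hmd, (f _).1, (f _).2]; omega
      · obtain ⟨q, hq, f⟩ := hoth i hi.1 hi.2
        simp only [hj.1, hmc', hmd', (f _).1, (f _).2]; omega
      · obtain ⟨q, hq, f⟩ := hoth i hi.1 hi.2
        obtain ⟨q', hq', f'⟩ := hoth j hj.1 hj.2
        simp only [(f _).1, (f _).2, (f' _).1, (f' _).2]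
    have hex : ∀ f : Fin l → B,
        ∏ i, f i = f m * (f m' * ∏ i ∈ (Finset.univ.erase m).erase m', f i) := by
      intro f
      rw [← Finset.mul_prod_erase _ _ (Finset.mem_univ m),
        ← Finset.mul_prod_erase _ _ (Finset.mem_erase.2 ⟨hne.symm, Finset.mem_univ m'⟩)]
    have hrest : ∀ e, ∏ i ∈ (Finset.univ.erase m).erase m', rowRed (optPos e (s i)) zPos z (t i) =
        ∏ i ∈ (Finset.univ.erase m).erase m', rowRed (optPos 0 (s i)) zPos z (t i) := by
      intro e
      refine Finset.prod_congr rfl fun i hi => ?_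
      simp only [Finset.mem_erase] at hi
      obtain ⟨q, hq, f⟩ := hoth i hi.2.1 hi.1
      rw [(f _).1, (f _).1]
    have hrest' : ∀ e, ∏ i ∈ (Finset.univ.erase m).erase m',
          rowRed (optPos e ((Equiv.swap none (some c) ∘ s) i)) zPos z (t i) =
        ∏ i ∈ (Finset.univ.erase m).erase m', rowRed (optPos 0 (s i)) zPos z (t i) := by
      intro e
      refine Finset.prod_congr rfl fun i hi => ?_
      simp only [Finset.mem_erase] at hi
      obtain ⟨q, hq, f⟩ := hoth i hi.2.1 hi.1
      rw [Function.comp_apply, (f _).1, (f _).2]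
    have hz : ∀ x : B, rowRed (2 * c.val + 1) zPos z x = rowRed c.val Fin.val z x :=
      fun x => rowRed_zPos c z x
    unfold redTerm
    rw [hcongr _ _ (Or.inl ⟨rfl, rfl⟩), hcongr _ _ (Or.inr ⟨rfl, rfl⟩), hW1, hW2]
    simp only [hex, hrest, hrest']
    simp only [Function.comp_apply, hmc, hmc', hmd, hmd', hz, (rowRed_free c z _).1,
      (rowRed_free c z _).2]
    ring
  · intro s hs _ h
    obtain ⟨m, hm⟩ := exists_of_mem_placements hs (x := none) (by simp)
    have := congrFun h m
    simp [hm] at this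
  · intro s hs
    exact comp_mem_placements hs _ (Equiv.injective _).injOn
      (image_swap_of_mem (by simpa using hc))
  · intro s hs
    funext i
    simp

/-- The coordinates of `e U` telescope. -/
theorem sum_redSum_insert (t : Fin l → B) (z : Fin n → B) (J : Finset (Fin n)) :
    ∑ c ∈ Finset.univ.filter (fun c => c ∉ J), redSum t z (insert c J) =
      freeSum n t z J - freeSum 0 t z J := by
  rw [← Finset.sum_range_sub (fun c => freeSum c t z J),
    ← Fin.sum_univ_eq_sum_range (fun c => freeSum (c + 1) t z J - freeSum c t z J),
    Finset.sum_filter]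
  refine Finset.sum_congr rfl fun c _ => ?_
  by_cases hc : c ∈ J
  · rw [if_neg (not_not.2 hc), freeSum_succ_of_mem t z hc]
  · rw [if_pos hc, freeSum_succ_of_notMem t z hc]

/-- Moving the free variable from the first to the last place compensates its shift by `κ`. -/
theorem orderedTerm_free_update (κ k k' : ℕ) {s : Fin l → Option (Fin n)}
    (hs : Function.Injective s) {m : Fin l} (hm : s m = none) (t : Fin l → B) (z : Fin n → B) :
    orderedTerm κ k k' (fun i => optPos n (s i)) zPos (Function.update t m (t m + κ)) z =
      orderedTerm κ k k' (fun i => optPos 0 (s i)) zPos t z := by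
  have hother : ∀ i, i ≠ m → ∃ a, s i = some a := fun i hi =>
    Option.ne_none_iff_exists'.1 (fun h => hi (hs (h.trans hm.symm)))
  unfold orderedTerm
  congr 1
  · refine Finset.prod_congr rfl fun i _ => Finset.prod_congr rfl fun a _ => ?_
    beta_reduce
    by_cases hi : i = m
    · subst hi
      rw [Function.update_self, hm, zFactor, zFactor, if_pos, if_neg, if_neg]
      · congr 1
        ring
      all_goals simp only [optPos, Option.elim, zPos]; omega
    · obtain ⟨b, hb⟩ := hother i hi
      rw [Function.update_of_ne hi, hb]
      rfl
  · refine pairProd_update κ k' m (fun i hi => ?_) (fun i hi => ?_) (fun i j hi hj _ => ?_) t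
    · obtain ⟨b, hb⟩ := hother i hi
      simp only [hm, hb, optPos, Option.elim, zPos]; omega
    · obtain ⟨b, hb⟩ := hother i hi
      simp only [hm, hb, optPos, Option.elim, zPos]; omega
    · obtain ⟨b, hb⟩ := hother i hi
      obtain ⟨b', hb'⟩ := hother j hj
      simp only [hb, hb', optPos, Option.elim]

/-! ### Cyclic rotation -/

theorem val_finRotate_symm {a : Fin n} :
    ((finRotate n).symm a).val = if a.val = 0 then n - 1 else a.val - 1 := by
  cases n with
  | zero => exact a.elim0
  | succ n =>
    split_ifs with h
    · have : a = 0 := Fin.ext h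
      subst this
      have : (finRotate (n + 1)).symm 0 = Fin.last n := by
        rw [Equiv.symm_apply_eq, finRotate_last]
      rw [this]; simp
    · exact coe_finRotate_symm_of_ne_zero (fun h' => h (by rw [h']; rfl))

/-- Shifting `z a` for the first index `a` has the same effect as moving `z a`, together with the
variable attached to it, to the last place, up to the shift of this variable. -/
theorem orderedTerm_rotate (κ k k' : ℕ) {a : Fin n} (ha : a.val = 0) {s : Fin l → Fin n}
    (hs : Function.Injective s) (t t' : Fin l → B) (z : Fin n → B)
    (ht : (∀ i, s i ≠ a) ∧ t' = t ∨ ∃ m, s m = a ∧ t' = Function.update t m (t m + κ)) :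
    orderedTerm κ k k' (fun i => ((finRotate n).symm (s i)).val) Fin.val t' (z ∘ finRotate n) =
      orderedTerm κ k k' (fun i => (s i).val) Fin.val t (Function.update z a (z a - κ)) := by
  have hlt : ∀ c d : Fin n, c ≠ a → d ≠ a →
      (c.val < d.val ↔ ((finRotate n).symm c).val < ((finRotate n).symm d).val) := by
    intro c d hc hd
    rw [ne_eq, Fin.ext_iff] at hc hd
    rw [val_finRotate_symm, val_finRotate_symm, if_neg (by omega), if_neg (by omega)]
    omega
  have htop : ∀ c : Fin n, c ≠ a →
      ((finRotate n).symm c).val < ((finRotate n).symm a).val := by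
    intro c hc
    have := c.isLt
    rw [ne_eq, Fin.ext_iff] at hc
    rw [val_finRotate_symm, val_finRotate_symm, if_neg (by omega), if_pos ha]
    omega
  unfold orderedTerm
  congr 1
  · refine Finset.prod_congr rfl fun i _ => ?_
    rw [← Equiv.prod_comp (finRotate n).symm]
    refine Finset.prod_congr rfl fun c _ => ?_
    simp only [Function.comp_apply, Equiv.apply_symm_apply]
    have heq : ((finRotate n).symm c).val = ((finRotate n).symm (s i)).val ↔ c.val = (s i).val := by
      rw [← Fin.ext_iff, ← Fin.ext_iff, (finRotate n).symm.injective.eq_iff]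
    by_cases hi : s i = a
    · have hti : t' i = t i + κ := by
        rcases ht with h | ⟨m, hm, h⟩
        · exact absurd hi (h.1 i)
        · have : i = m := hs (hi.trans hm.symm)
          subst this
          rw [h, Function.update_self]
      rw [hti]
      by_cases hc : c = a
      · rw [hc, hi, Function.update_self]
        simp only [zFactor, lt_irrefl, if_false, if_true]
        congr 1
        ring
      · rw [Function.update_of_ne hc, zFactor, if_pos (by rw [hi]; exact htop c hc), zFactor,
          if_neg (by rw [hi]; omega), if_neg (by rw [hi, ← Fin.ext_iff]; exact hc)]
        congr 1
        ring
    · have hti : t' i = t i := by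
        rcases ht with h | ⟨m, hm, h⟩
        · rw [h.2]
        · have : i ≠ m := fun h => hi (h ▸ hm)
          rw [h, Function.update_of_ne this]
      rw [hti]
      by_cases hc : c = a
      · have h1 := htop _ hi
        have h2 : (s i).val ≠ a.val := fun h => hi (Fin.ext h)
        rw [hc, Function.update_self, zFactor, if_neg (by omega), if_neg (by omega), zFactor,
          if_pos (by omega)]
        congr 1
        ring
      · rw [Function.update_of_ne hc]
        exact zFactor_congr κ k (hlt c (s i) hc hi).symm heq _
  · rcases ht with ⟨h, rfl⟩ | ⟨m, hm, rfl⟩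
    · exact pairProd_congr κ k' (fun i j _ => (hlt _ _ (h i) (h j)).symm) t'
    · have hne : ∀ i, i ≠ m → s i ≠ a := fun i hi h => hi (hs (h.trans hm.symm))
      refine pairProd_update κ k' m (fun i hi => ?_) (fun i hi => ?_) (fun i j hi hj _ => ?_) t
      · have : (s i).val ≠ a.val := fun h => hne i hi (Fin.ext h)
        simp only [hm]
        omega
      · simp only [hm]
        exact htop _ (hne i hi)
      · exact hlt _ _ (hne i hi) (hne j hj)

end Free

/-! ### Properties of difference integrals -/

section Integral

variable {B : Type*} [CommRing B] {l n : ℕ}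

theorem pochBasis_apply (B : Type*) [CommRing B] (l κ : ℕ) (e : Fin l → ℕ) :
    pochBasis B l κ e = pochMonomial B l κ e := by
  simp [pochBasis]

/-- The difference integral as a linear form over the ring of coefficients. -/
def diffIntegralHom (B : Type*) [CommRing B] {l : ℕ} (N κ : ℕ) (r : Fin l → ℕ) :
    MvPolynomial (Fin l) B →ₗ[B] B :=
  (intFactor N r : B) • ((Finsupp.lapply r).comp (pochBasis B l κ).repr.toLinearMap)

theorem diffIntegralHom_apply (N κ : ℕ) (r : Fin l → ℕ) (f : MvPolynomial (Fin l) B) :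
    diffIntegralHom B N κ r f = diffIntegral N κ r f := rfl

theorem diffIntegral_C_mul (N κ : ℕ) (r : Fin l → ℕ) (c : B) (f : MvPolynomial (Fin l) B) :
    diffIntegral N κ r (MvPolynomial.C c * f) = c * diffIntegral N κ r f := by
  rw [← diffIntegralHom_apply, ← diffIntegralHom_apply, MvPolynomial.C_mul', map_smul, smul_eq_mul]

theorem diffIntegral_pochMonomial (N κ : ℕ) (r e : Fin l → ℕ) :
    diffIntegral N κ r (pochMonomial B l κ e) = if e = r then (intFactor N r : B) else 0 := by
  rw [diffIntegral, ← pochBasis_apply, Module.Basis.repr_self, Finsupp.single_apply, mul_ite, mul_one,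
    mul_zero]

/-- An additive property of polynomials holds if it holds for the multiples of the products of
strings. -/
theorem pochMonomial_induction (κ : ℕ) {P : MvPolynomial (Fin l) B → Prop}
    (hadd : ∀ f g, P f → P g → P (f + g)) (h0 : P 0)
    (hmul : ∀ (c : B) (e : Fin l → ℕ), P (c • pochMonomial B l κ e)) (f : MvPolynomial (Fin l) B) : P f := by
  rw [← (pochBasis B l κ).linearCombination_repr f, Finsupp.linearCombination_apply, Finsupp.sum]
  refine Finset.sum_induction _ P hadd h0 fun e _ => ?_
  rw [pochBasis_apply]
  exact hmul _ e

theorem map_diffIntegral {C : Type*} [CommRing C] (φ : B →+* C) (N κ : ℕ) (r : Fin l → ℕ)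
    (f : MvPolynomial (Fin l) B) :
    φ (diffIntegral N κ r f) = diffIntegral N κ r (MvPolynomial.map φ f) := by
  induction f using pochMonomial_induction κ with
  | hadd f g hf hg =>
    rw [map_add]
    simp only [← diffIntegralHom_apply, map_add] at hf hg ⊢
    rw [hf, hg]
  | h0 => simp only [← diffIntegralHom_apply, map_zero]
  | hmul c e =>
    have h : MvPolynomial.map φ (pochMonomial B l κ e) = pochMonomial C l κ e := by
      simp only [pochMonomial, map_prod, map_poch, MvPolynomial.map_X]
    rw [← MvPolynomial.C_mul', map_mul, MvPolynomial.map_C, h, diffIntegral_C_mul,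
      diffIntegral_C_mul, map_mul, diffIntegral_pochMonomial, diffIntegral_pochMonomial]
    split_ifs <;> simp

theorem dvd_intFactor_mul {N : ℕ} (hN : 0 < N) (r : Fin l → ℕ) (i : Fin l) :
    N ∣ intFactor N r * (r i + 1) :=
  (Nat.sInf_mem (s := {m : ℕ | 0 < m ∧ ∀ i, N ∣ m * (r i + 1)})
    ⟨N, hN, fun _ => dvd_mul_right _ _⟩).2 i

/-- The translation of the variable `t m` by `κ`. -/
def shiftHom (B : Type*) [CommRing B] {l : ℕ} (κ : ℕ) (m : Fin l) :
    MvPolynomial (Fin l) B →ₐ[B] MvPolynomial (Fin l) B :=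
  MvPolynomial.aeval (Function.update MvPolynomial.X m (MvPolynomial.X m + (κ : MvPolynomial _ B)))

theorem shiftHom_X (κ : ℕ) (m : Fin l) (i : Fin l) :
    shiftHom B κ m (MvPolynomial.X i) =
      Function.update MvPolynomial.X m (MvPolynomial.X m + (κ : MvPolynomial _ B)) i := by
  simp [shiftHom]

/-- The discrete Leibniz rule `[x + κ]_e = [x]_e + κ e [x]_{e-1}`. -/
theorem poch_add (κ e : ℕ) (x : B) :
    poch κ e (x + κ) = poch κ e x + (κ * e : ℕ) * poch κ (e - 1) x := by
  cases e with
  | zero => simp [poch]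
  | succ e =>
    rw [poch_succ, add_sub_cancel_right, Nat.add_sub_cancel, poch, poch, Finset.prod_range_succ]
    push_cast
    ring

theorem pochMonomial_eq_mul (κ : ℕ) (m : Fin l) (e : Fin l → ℕ) :
    pochMonomial B l κ e = poch κ (e m) (MvPolynomial.X m) *
      ∏ i ∈ Finset.univ.erase m, poch κ (e i) (MvPolynomial.X i) :=
  (Finset.mul_prod_erase _ _ (Finset.mem_univ m)).symm

theorem shiftHom_pochMonomial (κ : ℕ) (m : Fin l) (e : Fin l → ℕ) :
    shiftHom B κ m (pochMonomial B l κ e) = pochMonomial B l κ e +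
      (κ * e m : ℕ) • pochMonomial B l κ (Function.update e m (e m - 1)) := by
  rw [pochMonomial_eq_mul κ m e, pochMonomial_eq_mul κ m (Function.update e m (e m - 1)), map_mul,
    map_prod]
  have h1 : ∏ i ∈ Finset.univ.erase m, shiftHom B κ m (poch κ (e i) (MvPolynomial.X i)) =
      ∏ i ∈ Finset.univ.erase m, poch κ (e i) (MvPolynomial.X i) := by
    refine Finset.prod_congr rfl fun i hi => ?_
    have := map_poch (shiftHom B κ m).toRingHom κ (e i) (MvPolynomial.X i)
    simp only [AlgHom.toRingHom_eq_coe, RingHom.coe_coe] at this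
    rw [this, shiftHom_X, Function.update_of_ne (Finset.ne_of_mem_erase hi)]
  have h2 : ∏ i ∈ Finset.univ.erase m,
        poch κ (Function.update e m (e m - 1) i) (MvPolynomial.X i : MvPolynomial (Fin l) B) =
      ∏ i ∈ Finset.univ.erase m, poch κ (e i) (MvPolynomial.X i) := by
    refine Finset.prod_congr rfl fun i hi => ?_
    rw [Function.update_of_ne (Finset.ne_of_mem_erase hi)]
  have h3 := map_poch (shiftHom B κ m).toRingHom κ (e m) (MvPolynomial.X m)
  simp only [AlgHom.toRingHom_eq_coe, RingHom.coe_coe] at h3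
  rw [h1, h2, h3, shiftHom_X, Function.update_self, Function.update_self, poch_add, nsmul_eq_mul]
  ring

/-- Modulo `N`, the difference integral is invariant under translations of the variables by `κ`:
the discrete analogue of Stokes' theorem. -/
theorem diffIntegral_shiftHom {N : ℕ} (hN : 0 < N) (hB : (N : B) = 0) (κ : ℕ) (r : Fin l → ℕ)
    (m : Fin l) (f : MvPolynomial (Fin l) B) :
    diffIntegral N κ r (shiftHom B κ m f) = diffIntegral N κ r f := by
  induction f using pochMonomial_induction κ with
  | hadd f g hf hg =>
    rw [map_add]
    simp only [← diffIntegralHom_apply, map_add] at hf hg ⊢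
    rw [hf, hg]
  | h0 => rw [map_zero]
  | hmul c e =>
    rw [map_smul, shiftHom_pochMonomial, ← diffIntegralHom_apply, map_smul, map_add, map_nsmul,
      ← diffIntegralHom_apply, map_smul]
    congr 1
    rw [add_eq_left, diffIntegralHom_apply, diffIntegral_pochMonomial]
    split_ifs with h
    · by_cases he : e m = 0
      · rw [he]; simp
      · have hr : r m + 1 = e m := by rw [← h, Function.update_self]; omega
        obtain ⟨q, hq⟩ := dvd_intFactor_mul hN r m
        have : ((κ * e m : ℕ) : B) * (intFactor N r : B) = 0 := by
          rw [← hr, ← Nat.cast_mul, show κ * (r m + 1) * intFactor N r = N * (κ * q) by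
            rw [mul_assoc, mul_comm (r m + 1), hq]; ring, Nat.cast_mul, hB, zero_mul]
        rw [nsmul_eq_mul, this]
    · rw [smul_zero]

/-- The coordinate `f_I = {U_I}_r` of the difference integral at a point `z` of an arbitrary
commutative ring. -/
def integralAt {l n : ℕ} (N κ k k' : ℕ) (r : Fin l → ℕ) (z : Fin n → B) (I : Finset (Fin n)) : B :=
  diffIntegral N κ r (integrandAt κ k k' (MvPolynomial.X : Fin l → MvPolynomial (Fin l) B)
    (fun a => MvPolynomial.C (z a)) I)

theorem map_integralAt {C : Type*} [CommRing C] (φ : B →+* C) (N κ k k' : ℕ) (r : Fin l → ℕ)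
    (z : Fin n → B) (I : Finset (Fin n)) :
    φ (integralAt N κ k k' r z I) = integralAt N κ k k' r (fun a => φ (z a)) I := by
  rw [integralAt, map_diffIntegral, map_integrandAt, integralAt]
  simp only [MvPolynomial.map_X, MvPolynomial.map_C]

theorem integralAt_eq_zero {N κ k k' : ℕ} {r : Fin l → ℕ} {z : Fin n → B} {I : Finset (Fin n)}
    (h : I.card ≠ l) : integralAt N κ k k' r z I = 0 := by
  rw [integralAt, integrandAt, placements_eq_empty h, Finset.sum_empty, ← diffIntegralHom_apply,
    map_zero]

theorem natCast_mul_natCast_C {κ k : ℕ} {c : B} (h : (κ : B) * k = c) :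
    (κ : MvPolynomial (Fin l) B) * (k : MvPolynomial (Fin l) B) = MvPolynomial.C c := by
  rw [← h, map_mul, map_natCast, map_natCast]

/-- The exchange relation for the coordinates of the difference integral. -/
theorem integralAt_swap {N κ k k' : ℕ} (hk : 0 < k) (hk' : 0 < k') (h : (κ : B) * k = -1)
    (h' : (κ : B) * k' = 2) (r : Fin l → ℕ) {a b : Fin n} (hab : a.val + 1 = b.val)
    (z : Fin n → B) (I : Finset (Fin n)) :
    (z a - z b - 1) * integralAt N κ k k' r (z ∘ Equiv.swap a b) I =
      (z a - z b) * integralAt N κ k k' r z (I.image (Equiv.swap a b)) -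
        integralAt N κ k k' r z I := by
  have h1 : (κ : MvPolynomial (Fin l) B) * (k : MvPolynomial (Fin l) B) = -1 := by
    rw [natCast_mul_natCast_C h, map_neg, map_one]
  have h2 : (κ : MvPolynomial (Fin l) B) * (k' : MvPolynomial (Fin l) B) = 2 := by
    rw [natCast_mul_natCast_C h', map_ofNat]
  unfold integralAt
  rw [← diffIntegral_C_mul, ← diffIntegral_C_mul, ← diffIntegralHom_apply, ← diffIntegralHom_apply,
    ← diffIntegralHom_apply, ← map_sub]
  congr 1
  simp only [integrandAt_eq hk hk' h1 h2]
  have hc := commonFactor_perm κ k k' (MvPolynomial.X : Fin l → MvPolynomial (Fin l) B)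
    (fun a => MvPolynomial.C (z a)) (Equiv.swap a b)
  have hr := redSum_swap hab (MvPolynomial.X : Fin l → MvPolynomial (Fin l) B)
    (fun a => MvPolynomial.C (z a)) I
  have hcomp : (fun c => MvPolynomial.C ((z ∘ Equiv.swap a b) c)) =
      (fun a => (MvPolynomial.C (z a) : MvPolynomial (Fin l) B)) ∘ Equiv.swap a b := rfl
  rw [hcomp, hc]
  simp only [map_sub, map_one]
  linear_combination (commonFactor κ k k' (MvPolynomial.X : Fin l → MvPolynomial (Fin l) B)
    (fun a => MvPolynomial.C (z a))) * hr

theorem shiftHom_orderedTerm (κ k k' : ℕ) (m : Fin l) (p : Fin l → ℕ) (pz : Fin n → ℕ)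
    (z : Fin n → B) :
    shiftHom B κ m (orderedTerm κ k k' p pz MvPolynomial.X (fun a => MvPolynomial.C (z a))) =
      orderedTerm κ k k' p pz
        (Function.update MvPolynomial.X m (MvPolynomial.X m + (κ : MvPolynomial (Fin l) B)))
        (fun a => MvPolynomial.C (z a)) := by
  have := map_orderedTerm (shiftHom B κ m).toRingHom κ k k' p pz MvPolynomial.X
    (fun a => MvPolynomial.C (z a))
  simp only [AlgHom.toRingHom_eq_coe, RingHom.coe_coe, shiftHom_X] at this
  rw [this]
  simp only [shiftHom, MvPolynomial.aeval_C, MvPolynomial.algebraMap_eq]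

/-- The cyclic relation: placement by placement, the two integrands are equal up to a translation of
the variable attached to `z a`, which the difference integral does not see. -/
theorem integralAt_rotate {N κ : ℕ} (k k' : ℕ) (hN : 0 < N) (hB : (N : B) = 0) (r : Fin l → ℕ)
    {a : Fin n} (ha : a.val = 0) (z : Fin n → B) (I : Finset (Fin n)) :
    integralAt N κ k k' r (Function.update z a (z a - κ)) I =
      integralAt N κ k k' r (z ∘ finRotate n) (I.image (finRotate n).symm) := by
  unfold integralAt integrandAt
  rw [sum_placements_comp (I := I) (finRotate n).symm (finRotate n)
    (fun _ _ => Equiv.apply_symm_apply _ _) (fun _ _ => Equiv.symm_apply_apply _ _) rfl]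
  simp only [← diffIntegralHom_apply, map_sum]
  refine Finset.sum_congr rfl fun s hs => ?_
  have hz : (fun c => (MvPolynomial.C (Function.update z a (z a - κ) c) : MvPolynomial (Fin l) B)) =
      Function.update (fun c => MvPolynomial.C (z c)) a
        (MvPolynomial.C (z a) - (κ : MvPolynomial (Fin l) B)) := by
    funext c
    by_cases hc : c = a
    · subst hc; simp
    · simp [hc]
  have hz' : (fun c => (MvPolynomial.C ((z ∘ finRotate n) c) : MvPolynomial (Fin l) B)) =
      (fun c => MvPolynomial.C (z c)) ∘ finRotate n := rfl
  have hinj := (mem_placements.1 hs).1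
  rw [hz]
  by_cases h : ∃ m, s m = a
  · obtain ⟨m, hm⟩ := h
    rw [diffIntegralHom_apply, diffIntegralHom_apply, ← diffIntegral_shiftHom hN hB κ r m
      (orderedTerm κ k k' (fun i => (((finRotate n).symm ∘ s) i).val) _ _ _), shiftHom_orderedTerm,
      hz']
    congr 1
    exact (orderedTerm_rotate κ k k' ha hinj MvPolynomial.X _
      (fun c => MvPolynomial.C (z c)) (Or.inr ⟨m, hm, rfl⟩)).symm
  · rw [hz']
    congr 1
    exact (orderedTerm_rotate κ k k' ha hinj MvPolynomial.X _
      (fun c => MvPolynomial.C (z c)) (Or.inl ⟨fun i hi => h ⟨i, hi⟩, rfl⟩)).symm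

/-- The singular vector relation: after telescoping, the integrands with the free variable in the
last and in the first place differ by a translation of this variable. -/
theorem sum_integralAt_insert {N κ k k' : ℕ} (hN : 0 < N) (hB : (N : B) = 0) (hk : 0 < k)
    (hk' : 0 < k') (h : (κ : B) * k = -1) (h' : (κ : B) * k' = 2) (r : Fin l → ℕ)
    (z : Fin n → B) (J : Finset (Fin n)) :
    ∑ c ∈ Finset.univ.filter (fun c => c ∉ J), integralAt N κ k k' r z (insert c J) = 0 := by
  have h1 : (κ : MvPolynomial (Fin l) B) * (k : MvPolynomial (Fin l) B) = -1 := by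
    rw [natCast_mul_natCast_C h, map_neg, map_one]
  have h2 : (κ : MvPolynomial (Fin l) B) * (k' : MvPolynomial (Fin l) B) = 2 := by
    rw [natCast_mul_natCast_C h', map_ofNat]
  unfold integralAt
  simp only [← diffIntegralHom_apply, integrandAt_eq hk hk' h1 h2, ← map_sum, ← Finset.mul_sum,
    sum_redSum_insert, mul_sub, freeSum]
  rw [Finset.mul_sum, Finset.mul_sum, ← Finset.sum_sub_distrib, map_sum]
  refine Finset.sum_eq_zero fun s hs => ?_
  rw [← orderedTerm_eq hk hk' h1 h2, ← orderedTerm_eq hk hk' h1 h2, map_sub, sub_eq_zero,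
    diffIntegralHom_apply, diffIntegralHom_apply]
  obtain ⟨m, hm⟩ := exists_of_mem_placements hs (x := none) (by simp)
  rw [← orderedTerm_free_update κ k k' (mem_placements.1 hs).1 hm, ← shiftHom_orderedTerm,
    diffIntegral_shiftHom hN hB]

end Integral

/-! ### The weight functions over a field -/

section Weight

variable {F : Type*} [Field F] {l n : ℕ}

theorem prod_zFactor_eq {κ k : ℕ} (hk : 0 < k) (c : Fin n) (x : Fin n → F) (hx : ∀ a, x a ≠ 0) :
    ∏ a, zFactor κ k c.val a.val (x a) = (∏ a, poch κ k (x a)) *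
      (1 / x c * ∏ a ∈ Finset.Iio c, (x a - (κ : F) * (k : F)) / x a) := by
  obtain ⟨k, rfl⟩ : ∃ j, k = j + 1 := ⟨k - 1, by omega⟩
  have h1 : 1 / x c = ∏ a, if a = c then 1 / x a else 1 := by
    rw [Finset.prod_ite_eq' Finset.univ c fun a => 1 / x a, if_pos (Finset.mem_univ c)]
  have h2 : ∏ a ∈ Finset.Iio c, (x a - (κ : F) * ((k + 1 : ℕ) : F)) / x a =
      ∏ a, if a < c then (x a - (κ : F) * ((k + 1 : ℕ) : F)) / x a else 1 := by
    rw [← Finset.prod_filter]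
    exact Finset.prod_congr (by ext; simp) fun _ _ => rfl
  rw [h1, h2, ← Finset.prod_mul_distrib, ← Finset.prod_mul_distrib]
  refine Finset.prod_congr rfl fun a _ => ?_
  have hxa := hx a
  unfold zFactor
  rcases lt_trichotomy a c with h | h | h
  · rw [if_pos (Fin.lt_def.1 h), if_neg h.ne, if_pos h, poch_succ_sub, poch_succ]
    field_simp
  · subst h
    rw [if_neg (lt_irrefl _), if_pos rfl, if_pos rfl, if_neg (lt_irrefl _), poch_succ]
    simp only [Nat.add_sub_cancel]
    field_simp
  · rw [if_neg (fun h' => lt_asymm h (Fin.lt_def.2 h')), if_neg (fun h' => h.ne (Fin.ext h').symm),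
      if_neg h.ne', if_neg (not_lt.2 h.le)]
    ring

/-- The term of `Φ w_I` for a permutation `τ` is the ordered product for the placement which sends
`τ p` to the `p`-th element of `I`. -/
theorem orderedTerm_eq_permAct {κ k k' : ℕ} (hk : 0 < k) (hk' : 0 < k') (t : Fin l → F)
    (z : Fin n → F) (hz : ∀ i a, t i - z a ≠ 0) (ht : ∀ i j, i ≠ j → t i - t j + 1 ≠ 0)
    (I : LSubset l n) (τ : Equiv.Perm (Fin l)) :
    orderedTerm κ k k' (fun i => (I.1.orderEmbOfFin I.2 (τ.symm i)).val) Fin.val t z =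
      ((∏ a, ∏ i, poch κ k (t i - z a)) *
        ∏ i : Fin l, ∏ j ∈ Finset.Ioi i, poch κ k' (t i - t j + 1)) *
        permAct κ k' τ (weightTerm κ k z I) t := by
  obtain ⟨k', rfl⟩ : ∃ j, k' = j + 1 := ⟨k' - 1, by omega⟩
  have hw : weightTerm κ k z I (fun i => t (τ i)) =
      ∏ i, (1 / (t i - z (I.1.orderEmbOfFin I.2 (τ.symm i))) *
        ∏ j ∈ Finset.Iio (I.1.orderEmbOfFin I.2 (τ.symm i)),
          (t i - z j - (κ : F) * (k : F)) / (t i - z j)) := by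
    rw [← Equiv.prod_comp τ]
    simp only [Equiv.symm_apply_apply]
    rfl
  unfold orderedTerm permAct
  rw [hw, mul_mul_mul_comm]
  congr 1
  · rw [Finset.prod_comm (f := fun a i => poch κ k (t i - z a)), ← Finset.prod_mul_distrib]
    exact Finset.prod_congr rfl fun i _ => prod_zFactor_eq hk _ _ (hz i)
  · unfold pairProd
    rw [← Finset.prod_mul_distrib]
    refine Finset.prod_congr rfl fun i _ => ?_
    rw [Finset.prod_filter, ← Finset.prod_mul_distrib]
    refine Finset.prod_congr rfl fun j hj => ?_
    have hij : i ≠ j := (Finset.mem_Ioi.1 hj).ne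
    have hne : τ.symm i ≠ τ.symm j := fun h => hij (τ.symm.injective h)
    have h0 := ht i j hij
    unfold pairFactor
    beta_reduce
    have hlt : (I.1.orderEmbOfFin I.2 (τ.symm i)).val < (I.1.orderEmbOfFin I.2 (τ.symm j)).val ↔
        τ.symm i < τ.symm j := by
      rw [← Fin.lt_def, (I.1.orderEmbOfFin I.2).lt_iff_lt]
    rcases lt_or_gt_of_ne hne with h | h
    · rw [if_pos (hlt.2 h), if_neg (not_lt.2 h.le), mul_one]
    · rw [if_neg (fun h' => lt_asymm h (hlt.1 h')), if_pos h, poch_succ_sub, poch_succ]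
      field_simp

theorem integrandAt_eq_symmetrize {κ k k' : ℕ} (hk : 0 < k) (hk' : 0 < k') (t : Fin l → F)
    (z : Fin n → F) (hz : ∀ i a, t i - z a ≠ 0) (ht : ∀ i j, i ≠ j → t i - t j + 1 ≠ 0)
    (I : LSubset l n) :
    integrandAt κ k k' t z I.1 = ((∏ a, ∏ i, poch κ k (t i - z a)) *
        ∏ i : Fin l, ∏ j ∈ Finset.Ioi i, poch κ k' (t i - t j + 1)) *
        symmetrize κ k' (weightTerm κ k z I) t := by
  unfold integrandAt symmetrize
  rw [Finset.mul_sum]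
  symm
  refine Finset.sum_bij (fun τ _ => fun i => I.1.orderEmbOfFin I.2 (τ.symm i)) ?_ ?_ ?_ ?_
  · intro τ _
    rw [mem_placements]
    refine ⟨(I.1.orderEmbOfFin I.2).injective.comp τ.symm.injective, ?_⟩
    apply Finset.coe_injective
    rw [Finset.coe_image, Finset.coe_univ, Set.image_univ]
    exact (τ.symm.surjective.range_comp _).trans (Finset.range_orderEmbOfFin _ _)
  · intro τ _ τ' _ h
    have : τ.symm = τ'.symm := by
      ext1 i
      exact (I.1.orderEmbOfFin I.2).injective (congrFun h i)
    exact Equiv.symm_bijective.injective this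
  · intro s hs
    have hmem : ∀ i, ∃ p, I.1.orderEmbOfFin I.2 p = s i := by
      intro i
      have := apply_mem_of_mem_placements hs i
      rw [← Finset.mem_coe, ← Finset.range_orderEmbOfFin I.1 I.2] at this
      exact this
    choose g hg using hmem
    have hinj : Function.Injective g := fun i j hij =>
      (mem_placements.1 hs).1 (by rw [← hg, ← hg, hij])
    refine ⟨(Equiv.ofBijective g (Finite.injective_iff_bijective.1 hinj)).symm, Finset.mem_univ _, ?_⟩
    funext i
    exact hg i
  · intro τ _
    exact (orderedTerm_eq_permAct hk hk' t z hz ht I τ).symm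

/-- The integrand `U_I` as a polynomial. -/
def integrandPoly (l n κ k k' : ℕ) (I : Finset (Fin n)) : PolyTZ l n :=
  integrandAt κ k k' MvPolynomial.X (fun a => MvPolynomial.C (MvPolynomial.X a)) I

theorem isIntegrand_integrandPoly {κ k k' : ℕ} (hk : 0 < k) (hk' : 0 < k') :
    IsIntegrand κ k k' (fun I : LSubset l n => integrandPoly l n κ k k' I.1) := by
  intro I
  have hinj : Function.Injective (algebraMap (PolyTZ l n) (RatTZ l n)) :=
    IsFractionRing.injective _ _
  have hz : ∀ (i : Fin l) (a : Fin n), algebraMap (PolyTZ l n) (RatTZ l n) (MvPolynomial.X i) -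
      algebraMap (PolyTZ l n) (RatTZ l n) (MvPolynomial.C (MvPolynomial.X a)) ≠ 0 := by
    intro i a h
    rw [← map_sub] at h
    have h' := (injective_iff_map_eq_zero _).1 hinj _ h
    have := congrArg MvPolynomial.constantCoeff h'
    simp at this
  have ht : ∀ i j : Fin l, i ≠ j → algebraMap (PolyTZ l n) (RatTZ l n) (MvPolynomial.X i) -
      algebraMap (PolyTZ l n) (RatTZ l n) (MvPolynomial.X j) + 1 ≠ 0 := by
    intro i j _ h
    rw [← map_sub, ← map_one (algebraMap (PolyTZ l n) (RatTZ l n)), ← map_add] at h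
    have h' := (injective_iff_map_eq_zero _).1 hinj _ h
    have := congrArg MvPolynomial.constantCoeff h'
    simp at this
  unfold integrandPoly
  rw [map_integrandAt, integrandAt_eq_symmetrize hk hk' _ _ hz ht, weightFn,
    masterPoly]
  simp only [map_mul, map_prod, map_poch, map_sub, map_add, map_one]

end Weight

/-! ### Coordinates in the tensor power -/

section Coordinates

variable {K : Type} [Field K] {n : ℕ}

/-- The positions of the factors `v_2` in the standard basis vector with index `x`. -/
def twoSet (x : Fin n → Fin 2) : Finset (Fin n) := Finset.univ.filter fun j => x j = 1

theorem mem_twoSet {x : Fin n → Fin 2} {j : Fin n} : j ∈ twoSet x ↔ x j = 1 := by simp [twoSet]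

theorem twoSet_comp (x : Fin n → Fin 2) (σ : Equiv.Perm (Fin n)) :
    twoSet (x ∘ σ) = (twoSet x).image σ.symm := by
  ext j
  simp only [mem_twoSet, Finset.mem_image, Function.comp_apply]
  constructor
  · intro h
    exact ⟨σ j, h, σ.symm_apply_apply j⟩
  · rintro ⟨i, hi, rfl⟩
    rwa [Equiv.apply_symm_apply]

theorem stdBasis_repr_tprod (w : Fin n → Fin 2 → K) (x : Fin n → Fin 2) :
    (stdBasis K n).repr (PiTensorProduct.tprod K w) x = ∏ i, w i (x i) := by
  simp [stdBasis]

theorem repr_permOp (a b : Fin n) (v : VTensor K n) (x : Fin n → Fin 2) :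
    (stdBasis K n).repr (permOp K a b v) x = (stdBasis K n).repr v (x ∘ Equiv.swap a b) := by
  induction v using PiTensorProduct.induction_on with
  | smul_tprod r w =>
    rw [map_smul, map_smul, map_smul, Finsupp.smul_apply, Finsupp.smul_apply]
    congr 1
    rw [permOp, LinearEquiv.coe_coe, PiTensorProduct.reindex_tprod, stdBasis_repr_tprod,
      stdBasis_repr_tprod, ← Equiv.prod_comp (Equiv.swap a b)]
    simp
  | add v w hv hw => simp only [map_add, Finsupp.add_apply, hv, hw]

theorem repr_diagAct_sl2e (v : VTensor K n) (x : Fin n → Fin 2) :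
    (stdBasis K n).repr (diagAct (sl2e K) v) x =
      ∑ a ∈ Finset.univ.filter (fun a => a ∉ twoSet x),
        (stdBasis K n).repr v (Function.update x a 1) := by
  induction v using PiTensorProduct.induction_on with
  | smul_tprod r w =>
    simp only [map_smul, Finsupp.smul_apply]
    rw [← Finset.smul_sum]
    congr 1
    rw [diagAct, LinearMap.sum_apply, map_sum, Finsupp.finsetSum_apply, Finset.sum_filter]
    refine Finset.sum_congr rfl fun a _ => ?_
    rw [PiTensorProduct.map_tprod, stdBasis_repr_tprod, stdBasis_repr_tprod,
      ← Finset.mul_prod_erase _ _ (Finset.mem_univ a),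
      ← Finset.mul_prod_erase _ (fun i => w i (Function.update x a 1 i)) (Finset.mem_univ a)]
    have h1 : ∏ i ∈ Finset.univ.erase a,
        (Function.update (fun _ => LinearMap.id) a (sl2e K) i) (w i) (x i) =
        ∏ i ∈ Finset.univ.erase a, w i (x i) := by
      refine Finset.prod_congr rfl fun i hi => ?_
      rw [Function.update_of_ne (Finset.ne_of_mem_erase hi), LinearMap.id_apply]
    have h2 : ∏ i ∈ Finset.univ.erase a, w i (Function.update x a 1 i) =
        ∏ i ∈ Finset.univ.erase a, w i (x i) := by
      refine Finset.prod_congr rfl fun i hi => ?_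
      rw [Function.update_of_ne (Finset.ne_of_mem_erase hi)]
    rw [h1, h2, Function.update_self, Function.update_self]
    simp only [mem_twoSet]
    generalize x a = y
    fin_cases y <;> simp [sl2e, Matrix.toLin'_apply, Matrix.mulVec, dotProduct, Fin.sum_univ_two]
  | add v w hv hw => simp only [map_add, Finsupp.add_apply, hv, hw, Finset.sum_add_distrib]

theorem diagAct_sl2h_vBasis (I : Finset (Fin n)) :
    diagAct (sl2h K) (vBasis K I) = ((n : K) - 2 * (I.card : K)) • vBasis K I := by
  have h : ∀ a : Fin n, PiTensorProduct.map (Function.update (fun _ => LinearMap.id) a (sl2h K))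
      (vBasis K I) = (if a ∈ I then (-1 : K) else 1) • vBasis K I := by
    intro a
    let w : Fin n → Fin 2 → K := fun j => Pi.single (if j ∈ I then (1 : Fin 2) else 0) (1 : K)
    have hw : (fun i => (Function.update (fun _ => LinearMap.id) a (sl2h K) i :
        (Fin 2 → K) →ₗ[K] Fin 2 → K) (w i)) =
        Function.update w a ((if a ∈ I then (-1 : K) else 1) • w a) := by
      funext i
      by_cases hi : i = a
      · subst hi
        rw [Function.update_self, Function.update_self]
        by_cases hI : i ∈ I <;> funext y <;> fin_cases y <;>
          simp [w, hI, sl2h, Matrix.toLin'_apply, Matrix.mulVec, dotProduct, Fin.sum_univ_two]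
      · rw [Function.update_of_ne hi, Function.update_of_ne hi, LinearMap.id_apply]
    rw [vBasis, PiTensorProduct.map_tprod]
    change PiTensorProduct.tprod K (fun i => (Function.update (fun _ => LinearMap.id) a (sl2h K) i :
        (Fin 2 → K) →ₗ[K] Fin 2 → K) (w i)) = _ • PiTensorProduct.tprod K w
    rw [hw, MultilinearMap.map_update_smul, Function.update_eq_self]
  rw [diagAct, LinearMap.sum_apply]
  simp only [h]
  rw [← Finset.sum_smul]
  congr 1
  have h2 : ∀ a : Fin n, (if a ∈ I then (-1 : K) else 1) = 1 - 2 * (if a ∈ I then 1 else 0) := by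
    intro a
    split_ifs <;> ring
  simp only [h2, Finset.sum_sub_distrib, ← Finset.mul_sum]
  simp

/-- The partial products of the adjacent transpositions are the cycles of initial segments. -/
theorem prod_swap_eq_finRotate (m : ℕ) :
    (List.ofFn fun i : Fin m => Equiv.swap i.castSucc i.succ).prod = finRotate (m + 1) := by
  have key : ∀ j c : Fin (m + 1),
      (Fin.partialProd (fun i : Fin m => Equiv.swap i.castSucc i.succ) j c).val =
        if c < j then c.val + 1 else if c = j then 0 else c.val := by
    intro j
    induction j using Fin.induction with
    | zero =>
      intro c
      rw [Fin.partialProd_zero, Equiv.Perm.one_apply]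
      by_cases hc : c = 0 <;> simp [hc]
    | succ j ih =>
      intro c
      rw [Fin.partialProd_succ, Equiv.Perm.mul_apply, ih]
      by_cases h1 : c = j.castSucc
      · rw [h1, Equiv.swap_apply_left]
        simp only [Fin.lt_def, Fin.ext_iff, Fin.val_castSucc, Fin.val_succ]
        split_ifs <;> omega
      · by_cases h2 : c = j.succ
        · rw [h2, Equiv.swap_apply_right]
          simp
        · rw [Equiv.swap_apply_of_ne_of_ne h1 h2]
          simp only [Fin.lt_def, Fin.ext_iff, Fin.val_castSucc, Fin.val_succ] at h1 h2 ⊢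
          split_ifs <;> omega
  have hlast : (List.ofFn fun i : Fin m => Equiv.swap i.castSucc i.succ).prod =
      Fin.partialProd (fun i : Fin m => Equiv.swap i.castSucc i.succ) (Fin.last m) := by
    rw [Fin.partialProd, List.take_of_length_le (by simp)]
  ext1 c
  apply Fin.ext
  rw [hlast, key, coe_finRotate]
  have := Fin.le_last c
  rcases this.eq_or_lt with h | h
  · simp [h]
  · simp [h, h.ne]

theorem repr_cycleOp (v : VTensor K n) (x : Fin n → Fin 2) :
    (stdBasis K n).repr (cycleOp K n v) x = (stdBasis K n).repr v (x ∘ finRotate n) := by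
  have key : ∀ {ι : Type} (L : List ι) (a b : ι → Fin n) (x : Fin n → Fin 2),
      (stdBasis K n).repr ((L.map fun i => permOp K (a i) (b i)).prod v) x =
        (stdBasis K n).repr v (x ∘ (L.map fun i => Equiv.swap (a i) (b i)).prod) := by
    intro ι L a b
    induction L with
    | nil => intro x; simp
    | cons i L ih =>
      intro x
      rw [List.map_cons, List.prod_cons, Module.End.mul_apply, repr_permOp, ih, List.map_cons,
        List.prod_cons, Equiv.Perm.coe_mul, Function.comp_assoc]
  cases n with
  | zero => simp [cycleOp]
  | succ m =>
    rw [cycleOp, key, ← prod_swap_eq_finRotate, List.ofFn_eq_map]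
    rfl

theorem repr_RMat (a b : Fin n) (u : K) (v : VTensor K n) (x : Fin n → Fin 2) :
    (stdBasis K n).repr (RMat a b u v) x = (u - 1)⁻¹ *
      (u * (stdBasis K n).repr v x - (stdBasis K n).repr v (x ∘ Equiv.swap a b)) := by
  rw [RMat, LinearMap.smul_apply, LinearMap.sub_apply, LinearMap.smul_apply, Module.End.one_apply,
    map_smul, map_sub, map_smul, Finsupp.smul_apply, Finsupp.sub_apply, Finsupp.smul_apply,
    repr_permOp, smul_eq_mul, smul_eq_mul]

theorem repr_vBasis (I : Finset (Fin n)) (x : Fin n → Fin 2) :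
    (stdBasis K n).repr (vBasis K I) x = if twoSet x = I then 1 else 0 := by
  have h : vBasis K I = stdBasis K n (fun j => if j ∈ I then 1 else 0) := by
    rw [stdBasis, Basis.piTensorProduct_apply, vBasis]
    simp
  rw [h, Module.Basis.repr_self, Finsupp.single_apply]
  congr 1
  apply propext
  constructor
  · rintro rfl
    ext j
    rw [mem_twoSet]
    by_cases hj : j ∈ I <;> simp [hj]
  · rintro rfl
    funext j
    simp only [mem_twoSet]
    generalize x j = y
    fin_cases y <;> simp

/-- The coordinates of the difference integral are the values of `integralAt`, which vanishes on the
sets whose cardinality is not `l`. -/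
theorem repr_vecAt {l : ℕ} (N κ k k' : ℕ) (r : Fin l → ℕ) (s : Fin n → PolyZ n)
    (x : Fin n → Fin 2) :
    (stdBasis (RatZ n) n).repr
        (vecAt (fun I : LSubset l n => diffIntegral N κ r (integrandPoly l n κ k k' I.1)) s) x =
      algebraMap (PolyZ n) (RatZ n) (integralAt N κ k k' r s (twoSet x)) := by
  have hs : ∀ I, MvPolynomial.bind₁ s (diffIntegral N κ r (integrandPoly l n κ k k' I)) =
      integralAt N κ k k' r s I := by
    intro I
    have := map_integralAt (MvPolynomial.bind₁ s).toRingHom N κ k k' r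
      (MvPolynomial.X : Fin n → PolyZ n) I
    simp only [AlgHom.toRingHom_eq_coe, RingHom.coe_coe, MvPolynomial.bind₁_X_right] at this
    exact this
  simp only [vecAt, map_sum, map_smul, Finsupp.finsetSum_apply, Finsupp.smul_apply, repr_vBasis, hs,
    smul_eq_mul, mul_ite, mul_one, mul_zero]
  by_cases hx : (twoSet x).card = l
  · rw [Finset.sum_eq_single (⟨twoSet x, hx⟩ : LSubset l n)]
    · simp
    · intro I _ hI
      rw [if_neg]
      exact fun h => hI (Subtype.ext h.symm)
    · exact fun h => absurd (Finset.mem_univ _) h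
  · rw [integralAt_eq_zero hx, map_zero]
    refine Finset.sum_eq_zero fun I _ => if_neg fun h => hx ?_
    rw [h, I.2]

theorem hasWeight {l : ℕ} (f : LSubset l n → PolyZ n) : HasWeight f := by
  unfold HasWeight vecAt
  rw [map_sum, Finset.smul_sum]
  refine Finset.sum_congr rfl fun I _ => ?_
  rw [map_smul, diagAct_sl2h_vBasis, smul_comm, I.2]

end Coordinates

/-! ### Congruences of rational functions -/

section Congruence

variable {n N : ℕ}

/-- The reduction of a polynomial modulo `N`. -/
abbrev modN (N n : ℕ) : PolyZ n →+* MvPolynomial (Fin n) (ZMod N) :=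
  MvPolynomial.map (Int.castRingHom (ZMod N))

theorem ratCongr_of_modN_eq {p q : PolyZ n} (h : modN N n p = modN N n q) :
    RatCongr N (algebraMap (PolyZ n) (RatZ n) p) (algebraMap (PolyZ n) (RatZ n) q) := by
  have h0 : modN N n (p - q) = 0 := by rw [map_sub, h, sub_self]
  obtain ⟨c, hc⟩ := (MvPolynomial.C_dvd_iff_zmod N (p - q)).2 h0
  refine ⟨c, 1, by rw [map_one]; exact one_mem _, ?_⟩
  rw [map_one, one_mul, ← map_sub, hc]
  simp

theorem RatCongr.refl (x : RatZ n) : RatCongr N x x :=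
  ⟨0, 1, by rw [map_one]; exact one_mem _, by simp⟩

theorem RatCongr.trans {x y w : RatZ n} (h1 : RatCongr N x y) (h2 : RatCongr N y w) :
    RatCongr N x w := by
  obtain ⟨p, q, hq, e⟩ := h1
  obtain ⟨p', q', hq', e'⟩ := h2
  refine ⟨p * q' + p' * q, q * q', by rw [map_mul]; exact mul_mem hq hq', ?_⟩
  simp only [map_mul, map_add] at e e' ⊢
  linear_combination algebraMap (PolyZ n) (RatZ n) q' * e + algebraMap (PolyZ n) (RatZ n) q * e'

theorem RatCongr.sub {x y x' y' : RatZ n} (h1 : RatCongr N x y) (h2 : RatCongr N x' y') :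
    RatCongr N (x - x') (y - y') := by
  obtain ⟨p, q, hq, e⟩ := h1
  obtain ⟨p', q', hq', e'⟩ := h2
  refine ⟨p * q' - p' * q, q * q', by rw [map_mul]; exact mul_mem hq hq', ?_⟩
  simp only [map_mul, map_sub] at e e' ⊢
  linear_combination algebraMap (PolyZ n) (RatZ n) q' * e - algebraMap (PolyZ n) (RatZ n) q * e'

theorem RatCongr.algebraMap_mul (c : PolyZ n) {x y : RatZ n} (h : RatCongr N x y) :
    RatCongr N (algebraMap (PolyZ n) (RatZ n) c * x) (algebraMap (PolyZ n) (RatZ n) c * y) := by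
  obtain ⟨p, q, hq, e⟩ := h
  refine ⟨c * p, q, hq, ?_⟩
  simp only [map_mul] at e ⊢
  linear_combination algebraMap (PolyZ n) (RatZ n) c * e

theorem RatCongr.inv_mul {d : PolyZ n} (hd0 : d ≠ 0) (hd : modN N n d ∈ nonZeroDivisors _)
    {x y : RatZ n} (h : RatCongr N x y) :
    RatCongr N ((algebraMap (PolyZ n) (RatZ n) d)⁻¹ * x)
      ((algebraMap (PolyZ n) (RatZ n) d)⁻¹ * y) := by
  obtain ⟨p, q, hq, e⟩ := h
  refine ⟨p, q * d, by rw [map_mul]; exact mul_mem hq hd, ?_⟩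
  have hd' : algebraMap (PolyZ n) (RatZ n) d ≠ 0 := by
    rwa [ne_eq, IsFractionRing.to_map_eq_zero_iff]
  rw [← e, map_mul]
  field_simp

theorem X_mem_nonZeroDivisors {B σ : Type*} [CommRing B] (a : σ) :
    (MvPolynomial.X a : MvPolynomial σ B) ∈ nonZeroDivisors (MvPolynomial σ B) := by
  rw [mem_nonZeroDivisors_iff_right]
  intro p hp
  ext m
  rw [← MvPolynomial.coeff_mul_X m a p, hp]
  simp

/-- A translation of the variables takes `z_a - z_b - c` to `z_a`. -/
theorem X_sub_X_sub_C_mem_nonZeroDivisors {B σ : Type*} [CommRing B] [DecidableEq σ] {a b : σ}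
    (hab : a ≠ b) (c : B) : (MvPolynomial.X a - MvPolynomial.X b - MvPolynomial.C c) ∈
      nonZeroDivisors (MvPolynomial σ B) := by
  let φ : MvPolynomial σ B →ₐ[B] MvPolynomial σ B := MvPolynomial.aeval
    (Function.update MvPolynomial.X a (MvPolynomial.X a + MvPolynomial.X b + MvPolynomial.C c))
  let ψ : MvPolynomial σ B →ₐ[B] MvPolynomial σ B := MvPolynomial.aeval
    (Function.update MvPolynomial.X a (MvPolynomial.X a - MvPolynomial.X b - MvPolynomial.C c))
  have hψφ : ∀ p, ψ (φ p) = p := by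
    intro p
    have : ψ.comp φ = AlgHom.id B _ := by
      refine MvPolynomial.algHom_ext fun i => ?_
      by_cases hi : i = a
      · subst hi
        simp [φ, ψ, hab.symm, MvPolynomial.algebraMap_eq]
        ring
      · simp [φ, ψ, hi]
    exact DFunLike.congr_fun this p
  rw [mem_nonZeroDivisors_iff_right]
  intro p hp
  have h1 : φ p * MvPolynomial.X a = 0 := by
    have := congrArg φ hp
    rw [map_mul, map_zero] at this
    rw [← this]
    congr 1
    simp [φ, hab.symm, MvPolynomial.algebraMap_eq]
    ring
  have h2 := (mem_nonZeroDivisors_iff_right.1 (X_mem_nonZeroDivisors a)) _ h1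
  rw [← hψφ p, h2, map_zero]

theorem RatCongr.inv_X_sub_X_mul (hN : 1 < N) {a b : Fin n} (hab : a ≠ b) (c : ℕ) {x y : RatZ n}
    (h : RatCongr N x y) :
    RatCongr N ((algebraMap (PolyZ n) (RatZ n) (MvPolynomial.X a - MvPolynomial.X b - (c : PolyZ n)))⁻¹ * x)
      ((algebraMap (PolyZ n) (RatZ n) (MvPolynomial.X a - MvPolynomial.X b - (c : PolyZ n)))⁻¹ * y) := by
  have hd : modN N n (MvPolynomial.X a - MvPolynomial.X b - (c : PolyZ n)) ∈ nonZeroDivisors _ := by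
    have := X_sub_X_sub_C_mem_nonZeroDivisors (B := ZMod N) hab c
    rw [map_natCast] at this
    simpa using this
  have : Fact (1 < N) := ⟨hN⟩
  refine RatCongr.inv_mul (fun h0 => ?_) hd h
  rw [h0, map_zero] at hd
  exact zero_notMem_nonZeroDivisors hd

/-- If the coordinates `g` and `g'` satisfy `(u - 1) g' = (u - P) g` modulo `N`, where
`u = z_a - z_b - c`, then `g'` is congruent to the coordinates of `R(u)` applied to `g`. -/
theorem ratCongr_RMat (hN : 1 < N) {a b : Fin n} (hab : a ≠ b) (c : ℕ) {u : RatZ n}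
    (hu : u = zVar a - zVar b - (c : RatZ n)) {g g' : (Fin n → Fin 2) → PolyZ n}
    {v : VTensor (RatZ n) n}
    (hg : ∀ x, RatCongr N (algebraMap _ _ (g x)) ((stdBasis (RatZ n) n).repr v x))
    (h : ∀ x, modN N n ((MvPolynomial.X a - MvPolynomial.X b - (c : PolyZ n) - 1) * g' x) =
      modN N n ((MvPolynomial.X a - MvPolynomial.X b - (c : PolyZ n)) * g x - g (x ∘ Equiv.swap a b)))
    (x : Fin n → Fin 2) :
    RatCongr N (algebraMap _ _ (g' x)) ((stdBasis (RatZ n) n).repr (RMat a b u v) x) := by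
  have hu' : u = algebraMap (PolyZ n) (RatZ n) (MvPolynomial.X a - MvPolynomial.X b - (c : PolyZ n)) := by
    rw [hu, zVar, zVar, map_sub, map_sub, map_natCast]
  have hd : u - 1 = algebraMap (PolyZ n) (RatZ n)
      (MvPolynomial.X a - MvPolynomial.X b - ((c + 1 : ℕ) : PolyZ n)) := by
    rw [hu', map_sub _ _ (c : PolyZ n), map_sub _ _ ((c + 1 : ℕ) : PolyZ n), map_natCast,
      map_natCast]
    push_cast
    ring
  have hd0 : (MvPolynomial.X a - MvPolynomial.X b - ((c + 1 : ℕ) : PolyZ n)) ≠ 0 := by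
    have h0 := X_sub_X_sub_C_mem_nonZeroDivisors (B := ℤ) hab ((c + 1 : ℕ) : ℤ)
    rw [map_natCast] at h0
    exact nonZeroDivisors.ne_zero h0
  have hd1 : u - 1 ≠ 0 := by
    rw [hd, ne_eq, IsFractionRing.to_map_eq_zero_iff]
    exact hd0
  have e : algebraMap (PolyZ n) (RatZ n) (g' x) = (u - 1)⁻¹ * algebraMap (PolyZ n) (RatZ n)
      ((MvPolynomial.X a - MvPolynomial.X b - (c : PolyZ n) - 1) * g' x) := by
    rw [map_mul, map_sub _ _ (1 : PolyZ n), map_one, ← hu']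
    field_simp
  rw [e, repr_RMat, hd]
  refine RatCongr.inv_X_sub_X_mul hN hab _ ((ratCongr_of_modN_eq (h x)).trans ?_)
  rw [map_sub, map_mul, ← hu', hu']
  exact (RatCongr.algebraMap_mul _ (hg x)).sub (hg _)

end Congruence

/-! ### The qKZ equations -/

section Equations

variable {n l N κ k k' : ℕ}

/-- The coordinate with index `x` of the vector obtained from `f(z_{σ(1)}, …, z_{σ(n)})` at `z = s` by
moving the `p`-th tensor factor to the place `σ p`, so that every point keeps its tensor factor. -/
abbrev coordAt (N κ k k' : ℕ) (r : Fin l → ℕ) (s : Fin n → PolyZ n) (σ : Equiv.Perm (Fin n))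
    (x : Fin n → Fin 2) : PolyZ n :=
  integralAt N κ k k' r (s ∘ σ) (twoSet (x ∘ σ))

/-- The conditions on `κ`, `k`, `k'` and `N`, as identities in a ring. -/
structure IsReduction (B : Type*) [CommRing B] (N κ k k' : ℕ) : Prop where
  one_lt : 1 < N
  k_pos : 0 < k
  k'_pos : 0 < k'
  cast_N : (N : B) = 0
  mul_k : (κ : B) * k = -1
  mul_k' : (κ : B) * k' = 2

theorem isReduction_mvPolynomial {σ : Type*} (hN : 1 < N) (hk : 0 < k) (hk' : 0 < k')
    (hkκ : (κ : ℤ) * (k : ℤ) ≡ -1 [ZMOD (N : ℤ)]) (hk'κ : (κ : ℤ) * (k' : ℤ) ≡ 2 [ZMOD (N : ℤ)]) :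
    IsReduction (MvPolynomial σ (ZMod N)) N κ k k' := by
  have h1 := (ZMod.intCast_eq_intCast_iff _ _ N).2 hkκ
  have h2 := (ZMod.intCast_eq_intCast_iff _ _ N).2 hk'κ
  push_cast at h1 h2
  refine ⟨hN, hk, hk', ?_, ?_, ?_⟩
  · rw [← map_natCast (MvPolynomial.C (R := ZMod N) (σ := σ)), ZMod.natCast_self, map_zero]
  · rw [← map_natCast (MvPolynomial.C (R := ZMod N) (σ := σ)),
      ← map_natCast (MvPolynomial.C (R := ZMod N) (σ := σ)), ← map_mul, h1, map_neg, map_one]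
  · rw [← map_natCast (MvPolynomial.C (R := ZMod N) (σ := σ)),
      ← map_natCast (MvPolynomial.C (R := ZMod N) (σ := σ)), ← map_mul, h2, map_ofNat]

theorem modN_coordAt_swap (H : IsReduction (MvPolynomial (Fin n) (ZMod N)) N κ k k')
    (r : Fin l → ℕ) (s : Fin n → PolyZ n) (σ : Equiv.Perm (Fin n)) {p q : Fin n}
    (hpq : p.val + 1 = q.val) (x : Fin n → Fin 2) :
    modN N n ((s (σ p) - s (σ q) - 1) * coordAt N κ k k' r s (σ * Equiv.swap p q) x) =
      modN N n ((s (σ p) - s (σ q)) * coordAt N κ k k' r s σ x -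
        coordAt N κ k k' r s σ (x ∘ Equiv.swap (σ p) (σ q))) := by
  have h := integralAt_swap (N := N) H.k_pos H.k'_pos H.mul_k H.mul_k' r hpq
    (fun c => modN N n (s (σ c))) (twoSet (x ∘ (σ * Equiv.swap p q : Equiv.Perm (Fin n))))
  have h1 : (twoSet (x ∘ (σ * Equiv.swap p q : Equiv.Perm (Fin n)))).image (Equiv.swap p q) =
      twoSet (x ∘ σ) := by
    rw [Equiv.Perm.coe_mul, ← Function.comp_assoc, twoSet_comp _ (Equiv.swap p q),
      Finset.image_image]
    simp [Function.comp_def]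
  have h2 : x ∘ (σ * Equiv.swap p q : Equiv.Perm (Fin n)) =
      (x ∘ Equiv.swap (σ p) (σ q)) ∘ σ := by
    rw [Equiv.mul_swap_eq_swap_mul, Equiv.Perm.coe_mul, Function.comp_assoc]
  rw [h1] at h
  simp only [map_mul, map_sub, map_one, coordAt, map_integralAt]
  rw [← h2]
  exact h

/-- The exchange of the points at two neighbouring places `p`, `q` corresponds to the `R`-matrix
acting in the tensor factors `σ p`, `σ q` of these points. -/
theorem ratCongr_coordAt_swap (H : IsReduction (MvPolynomial (Fin n) (ZMod N)) N κ k k')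
    (r : Fin l → ℕ) (s : Fin n → PolyZ n) (σ : Equiv.Perm (Fin n)) {p q : Fin n}
    (hpq : p.val + 1 = q.val) (c : ℕ)
    (hs : s (σ p) - s (σ q) = MvPolynomial.X (σ p) - MvPolynomial.X (σ q) - (c : PolyZ n))
    {u : RatZ n} (hu : u = zVar (σ p) - zVar (σ q) - (c : RatZ n)) {v : VTensor (RatZ n) n}
    (hv : ∀ x, RatCongr N (algebraMap _ _ (coordAt N κ k k' r s σ x))
      ((stdBasis (RatZ n) n).repr v x)) (x : Fin n → Fin 2) :
    RatCongr N (algebraMap _ _ (coordAt N κ k k' r s (σ * Equiv.swap p q) x))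
      ((stdBasis (RatZ n) n).repr (RMat (σ p) (σ q) u v) x) := by
  have hne : σ p ≠ σ q := fun h => by
    have := congrArg Fin.val (σ.injective h)
    omega
  refine ratCongr_RMat H.one_lt hne c hu hv (fun x => ?_) x
  rw [← hs]
  exact modN_coordAt_swap H r s σ hpq x

/-- If `P` is satisfied by the elements satisfying `Q` and by one larger element `q`, then `q` heads
the decreasing list of the elements satisfying `P`. -/
theorem filter_reverse_finRange_cons {P Q : Fin n → Prop} [DecidablePred P] [DecidablePred Q]
    (q : Fin n) (h : ∀ b, P b ↔ b = q ∨ Q b) (hq : ∀ b, Q b → b < q) :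
    (List.finRange n).reverse.filter (fun b => P b) =
      q :: (List.finRange n).reverse.filter (fun b => Q b) := by
  have hsort : (List.finRange n).reverse.Pairwise (· > ·) := by
    rw [List.pairwise_reverse]
    exact (List.sortedLT_finRange n).pairwise
  refine List.Pairwise.eq_of_mem_iff (r := (· > ·)) (hsort.filter _) ?_ ?_
  · rw [List.pairwise_cons]
    exact ⟨fun b hb => hq b (by simpa using hb), hsort.filter _⟩
  · intro b
    simp [h]

/-- Moving the point `z_a` to the right, from the place `a` to the place `d`. -/
theorem ratCongr_coordAt_right (H : IsReduction (MvPolynomial (Fin n) (ZMod N)) N κ k k')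
    (r : Fin l → ℕ) (a : Fin n) {v : VTensor (RatZ n) n}
    (hv : ∀ x, RatCongr N (algebraMap _ _ (coordAt N κ k k' r MvPolynomial.X 1 x))
      ((stdBasis (RatZ n) n).repr v x)) (d : ℕ) (had : a.val ≤ d) (hd : d < n)
    (σ : Equiv.Perm (Fin n))
    (hσ : ∀ c : Fin n, (σ c).val = if c.val < a.val then c.val else if c.val < d then c.val + 1 else
      if c.val = d then a.val else c.val) (x : Fin n → Fin 2) :
    RatCongr N (algebraMap _ _ (coordAt N κ k k' r MvPolynomial.X σ x))
      ((stdBasis (RatZ n) n).repr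
        ((((List.finRange n).reverse.filter (fun b => a < b ∧ b.val ≤ d)).map
          fun b => RMat a b (zVar a - zVar b)).prod v) x) := by
  induction d, had using Nat.le_induction generalizing σ x with
  | base =>
    have h1 : σ = 1 := by
      ext1 c
      apply Fin.ext
      rw [hσ, Equiv.Perm.one_apply]
      split_ifs <;> omega
    have h2 : (List.finRange n).reverse.filter (fun b => a < b ∧ b.val ≤ a.val) = [] := by
      rw [List.filter_eq_nil_iff]
      intro b _
      simp
    rw [h1, h2]
    exact hv x
  | succ d had ih =>
    let p : Fin n := ⟨d, by omega⟩
    let q : Fin n := ⟨d + 1, hd⟩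
    have hpv : p.val = d := rfl
    have hqv : q.val = d + 1 := rfl
    have hσ' : ∀ c : Fin n, ((σ * Equiv.swap p q) c).val = if c.val < a.val then c.val else
        if c.val < d then c.val + 1 else if c.val = d then a.val else c.val := by
      intro c
      rw [Equiv.Perm.mul_apply]
      by_cases h1 : c = p
      · rw [h1, Equiv.swap_apply_left, hσ]
        split_ifs <;> omega
      · by_cases h2 : c = q
        · rw [h2, Equiv.swap_apply_right, hσ]
          split_ifs <;> omega
        · rw [Equiv.swap_apply_of_ne_of_ne h1 h2, hσ]
          rw [Fin.ext_iff] at h1 h2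
          split_ifs <;> omega
    have hp : (σ * Equiv.swap p q) p = a := by
      apply Fin.ext
      rw [hσ']
      split_ifs <;> omega
    have hq : (σ * Equiv.swap p q) q = q := by
      apply Fin.ext
      rw [hσ']
      split_ifs <;> omega
    have hstep := ratCongr_coordAt_swap H r MvPolynomial.X (σ * Equiv.swap p q) (p := p) (q := q) rfl 0
      (by simp) (u := zVar a - zVar q) (by rw [hp, hq]; simp) (ih (by omega) _ hσ') x
    rw [mul_assoc, Equiv.swap_mul_self, mul_one, hp, hq] at hstep
    rw [filter_reverse_finRange_cons (Q := fun b => a < b ∧ b.val ≤ d) q, List.map_cons,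
      List.prod_cons, Module.End.mul_apply]
    · exact hstep
    · intro b
      rw [Fin.lt_def, Fin.ext_iff]
      omega
    · intro b hb
      rw [Fin.lt_def]
      omega

/-- Moving the point `z_a - κ` to the right, from the first place to the place `d`. -/
theorem ratCongr_coordAt_left (H : IsReduction (MvPolynomial (Fin n) (ZMod N)) N κ k k')
    (r : Fin l → ℕ) (a : Fin n) {v : VTensor (RatZ n) n}
    (hv : ∀ σ : Equiv.Perm (Fin n), (∀ c : Fin n, (σ c).val = if c.val = 0 then a.val else
        if c.val ≤ a.val then c.val - 1 else c.val) →
      ∀ x, RatCongr N (algebraMap _ _ (coordAt N κ k k' r (shiftVar κ a) σ x))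
        ((stdBasis (RatZ n) n).repr v x)) (d : ℕ) (hd : d ≤ a.val)
    (σ : Equiv.Perm (Fin n))
    (hσ : ∀ c : Fin n, (σ c).val = if c.val < d then c.val else if c.val = d then a.val else
      if c.val ≤ a.val then c.val - 1 else c.val) (x : Fin n → Fin 2) :
    RatCongr N (algebraMap _ _ (coordAt N κ k k' r (shiftVar κ a) σ x))
      ((stdBasis (RatZ n) n).repr
        ((((List.finRange n).reverse.filter (fun b => b.val < d)).map
          fun b => RMat a b (zVar a - zVar b - (κ : RatZ n))).prod v) x) := by
  induction d generalizing σ x with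
  | zero =>
    have h2 : (List.finRange n).reverse.filter (fun b => b.val < 0) = [] := by
      rw [List.filter_eq_nil_iff]
      intro b _
      simp
    rw [h2]
    refine hv σ (fun c => ?_) x
    rw [hσ]
    simp
  | succ d ih =>
    have han := a.isLt
    let p : Fin n := ⟨d, by omega⟩
    let q : Fin n := ⟨d + 1, by omega⟩
    have hpv : p.val = d := rfl
    have hqv : q.val = d + 1 := rfl
    have hσ' : ∀ c : Fin n, ((σ * Equiv.swap p q) c).val = if c.val < d then c.val else
        if c.val = d then a.val else if c.val ≤ a.val then c.val - 1 else c.val := by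
      intro c
      rw [Equiv.Perm.mul_apply]
      by_cases h1 : c = p
      · rw [h1, Equiv.swap_apply_left, hσ]
        split_ifs <;> omega
      · by_cases h2 : c = q
        · rw [h2, Equiv.swap_apply_right, hσ]
          split_ifs <;> omega
        · rw [Equiv.swap_apply_of_ne_of_ne h1 h2, hσ]
          rw [Fin.ext_iff] at h1 h2
          split_ifs <;> omega
    have hp : (σ * Equiv.swap p q) p = a := by
      apply Fin.ext
      rw [hσ']
      split_ifs <;> omega
    have hq : (σ * Equiv.swap p q) q = p := by
      apply Fin.ext
      rw [hσ']
      split_ifs <;> omega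
    have hpa : p ≠ a := by
      rw [ne_eq, Fin.ext_iff]
      omega
    have hstep := ratCongr_coordAt_swap H r (shiftVar κ a) (σ * Equiv.swap p q) (p := p) (q := q)
      rfl κ (by rw [hp, hq, shiftVar, Function.update_self, Function.update_of_ne hpa]; ring)
      (u := zVar a - zVar p - (κ : RatZ n)) (by rw [hp, hq]) (ih (by omega) _ hσ') x
    rw [mul_assoc, Equiv.swap_mul_self, mul_one, hp, hq] at hstep
    rw [filter_reverse_finRange_cons (Q := fun b => b.val < d) p, List.map_cons,
      List.prod_cons, Module.End.mul_apply]
    · exact hstep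
    · intro b
      rw [Fin.ext_iff]
      omega
    · intro b hb
      rw [Fin.lt_def]
      omega

/-- The point `z_a - κ` in the first place may be replaced by `z_a` in the last place; by the choice of
the coordinates, the tensor factors stay where they are. -/
theorem modN_coordAt_rotate (H : IsReduction (MvPolynomial (Fin n) (ZMod N)) N κ k k')
    (r : Fin l → ℕ) {a o : Fin n} (ho : o.val = 0) {σ : Equiv.Perm (Fin n)} (hσ : σ o = a)
    (x : Fin n → Fin 2) :
    modN N n (coordAt N κ k k' r (shiftVar κ a) σ x) =
      modN N n (coordAt N κ k k' r MvPolynomial.X (σ * finRotate n) x) := by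
  have h := integralAt_rotate (κ := κ) k k' (by have := H.one_lt; omega : 0 < N) H.cast_N r ho
    (fun c => modN N n (MvPolynomial.X (σ c))) (twoSet (x ∘ σ))
  rw [← twoSet_comp] at h
  rw [coordAt, coordAt, map_integralAt, map_integralAt]
  have hz : (fun c => modN N n ((shiftVar κ a ∘ σ) c)) =
      Function.update (fun c => modN N n (MvPolynomial.X (σ c))) o
        (modN N n (MvPolynomial.X (σ o)) - κ) := by
    funext c
    rw [Function.comp_apply, shiftVar]
    by_cases hc : c = o
    · rw [hc, hσ, Function.update_self, Function.update_self, map_sub, map_natCast]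
    · rw [Function.update_of_ne hc,
        Function.update_of_ne fun h => hc (σ.injective (h.trans hσ.symm))]
  rw [hz, h]
  rfl

theorem val_finRotate {c : Fin n} :
    (finRotate n c).val = if c.val = n - 1 then 0 else c.val + 1 := by
  cases n with
  | zero => exact c.elim0
  | succ n =>
    rw [coe_finRotate]
    simp [Fin.ext_iff]

theorem coordAt_one (r : Fin l → ℕ) (s : Fin n → PolyZ n) (x : Fin n → Fin 2) :
    coordAt N κ k k' r s 1 x = integralAt N κ k k' r s (twoSet x) := rfl

theorem solvesSymmQKZ (H : IsReduction (MvPolynomial (Fin n) (ZMod N)) N κ k k')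
    (r : Fin l → ℕ) :
    SolvesSymmQKZ N κ
      (fun I : LSubset l n => diffIntegral N κ r (integrandPoly l n κ k k' I.1)) := by
  constructor
  · intro a b hab x
    have h := ratCongr_coordAt_swap H r MvPolynomial.X 1 hab 0 (by simp)
      (u := zVar a - zVar b) (by simp) (v := vecAt (fun I : LSubset l n =>
        diffIntegral N κ r (integrandPoly l n κ k k' I.1)) MvPolynomial.X) (fun y => by
        rw [repr_vecAt, coordAt_one]
        exact RatCongr.refl _) (x ∘ Equiv.swap a b)
    rw [repr_permOp, repr_vecAt]
    rw [one_mul] at h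
    simp only [coordAt, Function.comp_assoc, ← Equiv.Perm.coe_mul, Equiv.swap_mul_self,
      Equiv.Perm.coe_one, Function.comp_id] at h
    exact h
  · intro a ha x
    rw [repr_cycleOp, repr_vecAt, repr_vecAt]
    have := modN_coordAt_rotate H r ha (σ := 1) (a := a) rfl x
    rw [one_mul] at this
    exact ratCongr_of_modN_eq this

theorem solvesQKZ (H : IsReduction (MvPolynomial (Fin n) (ZMod N)) N κ k k') (r : Fin l → ℕ) :
    SolvesQKZ N κ (fun I : LSubset l n => diffIntegral N κ r (integrandPoly l n κ k k' I.1)) := by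
  intro a x
  have han := a.isLt
  rw [repr_vecAt, ← coordAt_one, qKZOp, Module.End.mul_apply]
  have e1 : (List.finRange n).reverse.filter (fun b => a < b) =
      (List.finRange n).reverse.filter (fun b => a < b ∧ b.val ≤ n - 1) := by
    refine List.filter_congr fun b _ => ?_
    have : b.val ≤ n - 1 := by omega
    simp [this]
  have e2 : (List.finRange n).reverse.filter (fun b => b < a) =
      (List.finRange n).reverse.filter (fun b => b.val < a.val) := rfl
  rw [e1, e2]
  refine ratCongr_coordAt_left H r a (fun σ hσ y => ?_) a.val le_rfl 1 (fun c => ?_) x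
  -- The vector at which `z_a - κ` starts in the first place is the one at which `z_a` has arrived in
  -- the last place.
  · have h0 : σ ⟨0, by omega⟩ = a := by
      apply Fin.ext
      rw [hσ]
      simp
    refine (ratCongr_of_modN_eq (modN_coordAt_rotate H r (o := ⟨0, by omega⟩) rfl h0 y)).trans ?_
    refine ratCongr_coordAt_right H r a (fun w => ?_) (n - 1) (by omega) (by omega) _
      (fun c => ?_) y
    · rw [repr_vecAt, coordAt_one]
      exact RatCongr.refl _
    · have := c.isLt
      rw [Equiv.Perm.mul_apply, hσ, val_finRotate]
      by_cases hc : c.val = n - 1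
      · simp only [hc, if_true]
        split_ifs <;> omega
      · simp only [hc, if_false, Nat.succ_ne_zero]
        split_ifs <;> omega
  · rw [Equiv.Perm.one_apply]
    split_ifs <;> omega

theorem isSingularMod (H : IsReduction (MvPolynomial (Fin n) (ZMod N)) N κ k k')
    (r : Fin l → ℕ) :
    IsSingularMod N
      (fun I : LSubset l n => diffIntegral N κ r (integrandPoly l n κ k k' I.1)) := by
  intro x
  have hx : ∀ a, twoSet (Function.update x a 1) = insert a (twoSet x) := by
    intro a
    ext j
    rw [Finset.mem_insert, mem_twoSet, mem_twoSet]
    by_cases hj : j = a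
    · simp [hj]
    · simp [hj]
  rw [repr_diagAct_sl2e]
  simp only [repr_vecAt, hx]
  rw [← map_sum, map_zero, Finsupp.zero_apply, ← map_zero (algebraMap (PolyZ n) (RatZ n))]
  apply ratCongr_of_modN_eq
  simp only [map_zero, map_sum, map_integralAt]
  exact sum_integralAt_insert (by have := H.one_lt; omega) H.cast_N H.k_pos H.k'_pos H.mul_k
    H.mul_k' r _ _

end Equations

end

theorem mainTheorem1 (n l N κ k k' : ℕ) (hn : 1 < n) (hl : l ≤ n)
    (hκ : 0 < κ) (hκN : κ < N) (hcop : Nat.Coprime κ N)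
    (hk : 0 < k) (hk' : 0 < k')
    (hkκ : (κ : ℤ) * (k : ℤ) ≡ -1 [ZMOD (N : ℤ)])
    (hk'κ : (κ : ℤ) * (k' : ℤ) ≡ 2 [ZMOD (N : ℤ)]) :
    ∃ U : LSubset l n → PolyTZ l n, IsIntegrand κ k k' U ∧
      ∀ r : Fin l → ℕ,
        HasWeight (fun I => diffIntegral N κ r (U I)) ∧
        SolvesSymmQKZ N κ (fun I => diffIntegral N κ r (U I)) ∧
        SolvesQKZ N κ (fun I => diffIntegral N κ r (U I)) ∧
        IsSingularMod N (fun I => diffIntegral N κ r (U I)) := by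
  have H : IsReduction (MvPolynomial (Fin n) (ZMod N)) N κ k k' :=
    isReduction_mvPolynomial (by omega) hk hk' hkκ hk'κ
  exact ⟨fun I => integrandPoly l n κ k k' I.1, isIntegrand_integrandPoly hk hk', fun r =>
    ⟨hasWeight _, solvesSymmQKZ H r, solvesQKZ H r, isSingularMod H r⟩⟩
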